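/- **Setting.** Let $m,d,k\in\mathbb N_0$ and $D=m+1+d+k$. For real $a\le b$ and $r>1$ let $B([-1,1],r)\subset\mathbb C$ be the open region bounded by the ellipse with foci $\pm1$ whose semi-axes sum up to $r$, and let $B([a,b],r)$ be its image under the affine map $w\mapsto \frac{a+b}2+\frac{b-a}2w$; for a hyperrectangle $\mathcal Q=\prod_i[a_i,b_i]$ and $\varrho=(\varrho_i)\in(1,\infty)^n$ let $B(\mathcal Q,\varrho)=\prod_iB([a_i,b_i],\varrho_i)$ (generalized Bernstein ellipse). For $g:\mathcal Q\to\mathbb R$ and $\overline N=(N_i)$, $N_i\in\mathbb N_0$, let $I_{\overline N}(g)$ be the tensorized Chebyshev interpolation of $g$: for $\mathcal Q=[-1,1]^n$, $$I_{\overline N}(g)(p)=\sum_{j:\,0\le j_i\le N_i}c_j\prod_i\cos(j_i\arccos p_i),\qquad c_j=\Big(\prod_i\frac{2^{1_{\{0<j_i<N_i\}}}}{N_i}\Big)\sum_{k_1=0}^{N_1}{}^{''}\cdots\sum_{k_n=0}^{N_n}{}^{''}g\Big(\Big(\cos\frac{\pi k_i}{N_i}\Big)_i\Big)\prod_i\cos\frac{j_i\pi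 k_i}{N_i},$$ where $\sum''$ halves the first and the last summand (if $N_i=0$, direction $i$ is interpolated by the constant through the node $1$), and for general $\mathcal Q$ it is transported from $[-1,1]^n$ by the affine map. Let $\mathcal P=\mathcal P^1\times\mathcal P^2\subset\mathbb R^D$ be a hyperrectangle with $\mathcal P^1\subset\mathbb R^m$ and $\mathcal P^2=[\underline T,\overline T]\times\mathcal X\times\Pi'\subset[0,\infty)\times\mathbb R^d\times\mathbb R^k$; one-point intervals are allowed. Let $\mathfrak D\subset\mathbb R^d$ with $\mathcal X\subset\mathfrak D$, and for $\pi'\in\Pi'$ let $X^{\pi'}$ be an affine process with state space $\mathfrak D$, i.e. a time-homogeneous Markov process for which there are a $\mathbb C$-valued function $\nu^{\pi'}$ and a $\mathbb C^d$-valued function $\phi^{\pi'}$ with $$E\big(e^{i\langle z,X^{\pi'}_t\rangle}\,\big|\,X^{\pi'}_0=x\big)=e^{\nu^{\pi'}(t,iz)+\langle\phi^{\pi'}(t,iz),x\rangle}\qquad(t\ge0,\ z\in\mathbb R^d,\ x\in\mathfrak D),$$ where $\langle\cdot,\cdot\rangle$ is bilinear. For $K\in\mathcal P^1$ let $f^K:\mathbb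 R^d\to[0,\infty)$ be measurable payoffs, and for $p=(K,t,x,\pi')\in\mathcal P$ let $$\mathrm{Price}^{p}=E\big(f^K(X^{\pi'}_t)\,\big|\,X^{\pi'}_0=x\big).$$ Let $\eta\in\mathbb R^d$ and $\varrho^1\in(1,\infty)^m$, and write $\widehat{f^K}(z-i\eta)=\int_{\mathbb R^d}e^{i\langle z,y\rangle}e^{\langle\eta,y\rangle}f^K(y)\,dy$ for $z\in\mathbb R^d$. **Corollary.** Assume - (A1) $y\mapsto e^{\langle\eta,y\rangle}f^K(y)$ is in $L^1(\mathbb R^d)$ for every $K\in\mathcal P^1$; - (A2) for every $z\in\mathbb R^d$ the map $K\mapsto\widehat{f^K}(z-i\eta)$ extends analytically to $B(\mathcal P^1,\varrho^1)$, and there are $c_1,c_2>0$ with $\sup_{K\in B(\mathcal P^1,\varrho^1)}|\widehat{f^K}(-z-i\eta)|\le c_1e^{c_2|z|}$ for all $z\in\mathbb R^d$; - (A3) $E\big(e^{-\langle\eta,X^{\pi'}_t\rangle}\,\big|\,X_0^{\pi'}=x\big)<\infty$ for every $(t,x,\pi')\in\mathcal P^2$; and moreover - (i) for every $(t,x,\pi')\in\mathcal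 P^2$ the affine transform formula extends to $\mathbb R^d+i\eta$, i.e. for every $z\in\mathbb R^d+i\eta$, $E\big(e^{i\langle z,X^{\pi'}_t\rangle}\,\big|\,X^{\pi'}_0=x\big)=e^{\nu^{\pi'}(t,iz)+\langle\phi^{\pi'}(t,iz),x\rangle}$; - (ii) there is $\varrho'\in(1,\infty)^{1+k}$ such that for every $z\in\mathbb R^d$ the maps $(t,\pi')\mapsto\nu^{\pi'}(t,iz-\eta)$ and $(t,\pi')\mapsto\phi^{\pi'}(t,iz-\eta)$ have analytic extensions from $[\underline T,\overline T]\times\Pi'$ to the generalized Bernstein ellipse $B([\underline T,\overline T]\times\Pi',\varrho')$; - (iii) there are $\alpha\in(1,2]$, constants $C_1,C_2>0$ and $\widetilde\varrho^2\in(1,\infty)^{1+d+k}$ such that, for these extensions, uniformly in $(t,x,\pi')\in B(\mathcal P^2,\widetilde\varrho^2)$, $$\Re\big(\nu^{\pi'}(t,iz-\eta)+\langle\phi^{\pi'}(t,iz-\eta),x\rangle\big)\le C_1-C_2|z|^\alpha\qquad\text{for all }z\in\mathbb R^d.$$ Then all prices $\mathrm{Price}^p$, $p\in\mathcal P$, are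 finite, and there exist constants $C>0$ and $\underline\varrho>1$ such that for all $\overline N\in\mathbb N_0^D$, with $\underline N=\min_{1\le i\le D}N_i$, $$\big|\mathrm{Price}^p-I_{\overline N}(\mathrm{Price}^{(\cdot)})(p)\big|\le C\,\underline\varrho^{-\underline N}\qquad\text{for all }p\in\mathcal P.$$ -/

import Mathlib

open MeasureTheory
open scoped NNReal ENNReal

noncomputable section

namespace ChebAffine

/-! ### Hyperrectangles and (generalized) Bernstein ellipses -/

/-- The hyperrectangle `∏ᵢ [lo i, hi i]`. -/
def box {ι : Type*} (lo hi : ι → ℝ) : Set (ι → ℝ) :=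
  {p | ∀ i, lo i ≤ p i ∧ p i ≤ hi i}

/-- The open Bernstein ellipse `B([-1,1], ϱ)`: the region inside the ellipse with foci `±1` and
semi-axes `(ϱ + ϱ⁻¹) / 2` and `(ϱ - ϱ⁻¹) / 2` (which sum up to `ϱ`), written through the sum of the
distances to the foci, which is twice the semimajor axis on the ellipse. -/
def bernsteinEllipse (ϱ : ℝ) : Set ℂ :=
  {w | ‖w - 1‖ + ‖w + 1‖ < ϱ + ϱ⁻¹}

/-- The affine map taking `[-1,1]` to `[a,b]`, as a map of the complex plane: it sends the real
part `s` to `b + (a - b) / 2 * (1 - s)` and the imaginary part `s` to `(b - a) / 2 * s`. -/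
def ellipseMap (a b : ℝ) (w : ℂ) : ℂ :=
  ⟨b + (a - b) / 2 * (1 - w.re), (b - a) / 2 * w.im⟩

/-- The generalized Bernstein ellipse `B(𝒫, ϱ)` around the hyperrectangle `𝒫 = ∏ᵢ [lo i, hi i]`,
the product of the transformed Bernstein ellipses `B([lo i, hi i], ϱ i)`. -/
def genBernsteinEllipse {ι : Type*} (lo hi ϱ : ι → ℝ) : Set (ι → ℂ) :=
  {p | ∀ i, p i ∈ ellipseMap (lo i) (hi i) '' bernsteinEllipse (ϱ i)}

/-- A real parameter vector regarded as a complex one. -/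
def toComplex {ι : Type*} (p : ι → ℝ) : ι → ℂ := fun i => (p i : ℂ)

/-! ### Tensorized Chebyshev interpolation -/

/-- The Chebyshev polynomial `T_j(s) = cos (j arccos s)`, for `s ∈ [-1,1]`. -/
def chebT (j : ℕ) (s : ℝ) : ℝ := Real.cos (j * Real.arccos s)

/-- The Chebyshev node `cos (π k / n)`. -/
def chebNode (n k : ℕ) : ℝ := Real.cos (Real.pi * (k / n))

/-- The factor `2 ^ 1_{0<j<n} / n` of a Chebyshev coefficient.  (For `n = 0` it is `1`, so that
interpolation of degree `0` is the constant through the only node.) -/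
def chebFactor (n j : ℕ) : ℝ :=
  if n = 0 then 1 else (if 0 < j ∧ j < n then 2 else 1) / n

/-- The weight of the `k`-th summand in the sum `∑''` over `0 ≤ k ≤ n`, whose first and last
summands are halved.  (For `n = 0` the only summand has weight `1`.) -/
def chebWeight (n k : ℕ) : ℝ :=
  if n = 0 then 1 else if k = 0 ∨ k = n then 1 / 2 else 1

section Interpolation

variable {ι : Type*} [Fintype ι] [DecidableEq ι]

/-- The multi-indices `j` with `0 ≤ j i ≤ N i` for all `i`. -/
def multiIdx (N : ι → ℕ) : Finset (ι → ℕ) :=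
  Fintype.piFinset fun i => Finset.range (N i + 1)

/-- The coefficient `c_j` of the Chebyshev interpolation of `g` on `[-1,1]^ι`. -/
def chebCoeff (N : ι → ℕ) (g : (ι → ℝ) → ℝ) (j : ι → ℕ) : ℝ :=
  (∏ i, chebFactor (N i) (j i)) *
    ∑ k ∈ multiIdx N, (∏ i, chebWeight (N i) (k i)) * g (fun i => chebNode (N i) (k i)) *
      ∏ i, Real.cos (j i * Real.pi * (k i / N i))

/-- The Chebyshev interpolation of `g` on `[-1,1]^ι`. -/
def chebInterpUnit (N : ι → ℕ) (g : (ι → ℝ) → ℝ) (q : ι → ℝ) : ℝ :=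
  ∑ j ∈ multiIdx N, chebCoeff N g j * ∏ i, chebT (j i) (q i)

/-- The affine map `τ_𝒫 : [-1,1]^ι → 𝒫 = ∏ᵢ [lo i, hi i]`. -/
def boxMap (lo hi : ι → ℝ) (q : ι → ℝ) : ι → ℝ :=
  fun i => hi i + (lo i - hi i) / 2 * (1 - q i)

/-- The inverse transform `𝒫 → [-1,1]^ι`.  (If `lo i = hi i`, the value in direction `i` is `0`,
which `boxMap` takes to the only point `lo i`.) -/
def boxMapInv (lo hi : ι → ℝ) (p : ι → ℝ) : ι → ℝ :=
  fun i => (2 * p i - lo i - hi i) / (hi i - lo i)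

/-- The Chebyshev interpolation `I_N(g)` of `g` on the hyperrectangle `∏ᵢ [lo i, hi i]`. -/
def chebInterp (lo hi : ι → ℝ) (N : ι → ℕ) (g : (ι → ℝ) → ℝ) (p : ι → ℝ) : ℝ :=
  chebInterpUnit N (fun q => g (boxMap lo hi q)) (boxMapInv lo hi p)

end Interpolation

/-! ### Parameters

A parameter is `p = (p¹, p²)` with payoff parameters `p¹ ∈ ℝᵐ` and `p² = (t, x, π')`, where
`t ∈ ℝ` is the maturity, `x ∈ ℝᵈ` the initial state and `π' ∈ ℝᵏ` are the model parameters. -/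

/-- Coordinates of `p² = (t, x, π')`. -/
abbrev ModelIdx (d k : ℕ) : Type := Unit ⊕ (Fin d ⊕ Fin k)

/-- Coordinates of `p = (p¹, p²)`. -/
abbrev ParamIdx (m d k : ℕ) : Type := Fin m ⊕ ModelIdx d k

section Projections

variable {m d k : ℕ} {R : Type*}

/-- The part `p¹` of `p = (p¹, p²)`. -/
def payoffPart (p : ParamIdx m d k → R) : Fin m → R := fun i => p (Sum.inl i)

/-- The part `p²` of `p = (p¹, p²)`. -/
def modelPart (p : ParamIdx m d k → R) : ModelIdx d k → R := fun i => p (Sum.inr i)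

/-- The maturity `t` in `(t, x, π')`. -/
def timePart (q : ModelIdx d k → R) : R := q (Sum.inl ())

/-- The initial state `x` in `(t, x, π')`. -/
def statePart (q : ModelIdx d k → R) : Fin d → R := fun j => q (Sum.inr (Sum.inl j))

/-- The model parameter `π'` in `(t, x, π')`. -/
def affinePart (q : ModelIdx d k → R) : Fin k → R := fun l => q (Sum.inr (Sum.inr l))

/-- The part `(t, π')` of `(t, x, π')`. -/
def timeAffinePart (q : ModelIdx d k → R) : Unit ⊕ Fin k → R :=
  Sum.elim (fun _ => timePart q) (affinePart q)

end Projections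

/-! ### Affine processes -/

section Affine

variable {d : ℕ}

/-- The bilinear pairing `⟨u, v⟩ = ∑ⱼ uⱼ vⱼ` on `ℂᵈ`. -/
def pairing (u v : Fin d → ℂ) : ℂ := ∑ j, u j * v j

/-- The vector `i z - η = i (z + i η) ∈ ℂᵈ`. -/
def shifted (η z : EuclideanSpace ℝ (Fin d)) : Fin d → ℂ :=
  fun j => Complex.I * (z j : ℂ) - (η j : ℂ)

/-- A vector of `ℝᵈ` as a vector of `ℂᵈ`. -/
def vecC (x : EuclideanSpace ℝ (Fin d)) : Fin d → ℂ := fun j => (x j : ℂ)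

variable {Ω : Type*} [MeasurableSpace Ω]

/-- `(X, (P x)_{x ∈ 𝔇})` is a time-homogeneous Markov process with state space `𝔇 ⊆ ℝᵈ`;
`P x` is the law under which the process starts at `x`, i.e. `E (· | X₀ = x)` is the expectation
under `P x`. -/
structure IsMarkovProcess (𝔇 : Set (EuclideanSpace ℝ (Fin d)))
    (X : ℝ≥0 → Ω → EuclideanSpace ℝ (Fin d))
    (P : EuclideanSpace ℝ (Fin d) → Measure Ω) : Prop where
  mem_state : ∀ t ω, X t ω ∈ 𝔇
  measurable : ∀ t, Measurable (X t)
  isProbabilityMeasure : ∀ x ∈ 𝔇, IsProbabilityMeasure (P x)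
  start : ∀ x ∈ 𝔇, ∀ᵐ ω ∂(P x), X 0 ω = x
  measurable_transition : ∀ t (B : Set (EuclideanSpace ℝ (Fin d))), MeasurableSet B →
    Measurable fun x : 𝔇 => P x (X t ⁻¹' B)
  /-- `P x (X (s + t) ∈ B | σ (X r, r ≤ s)) = P (X s) (X t ∈ B)` almost surely. -/
  markov : ∀ x ∈ 𝔇, ∀ (s t : ℝ≥0) (A : Set Ω) (B : Set (EuclideanSpace ℝ (Fin d))),
    MeasurableSet[⨆ r : Set.Iic s, MeasurableSpace.comap (X r) inferInstance] A →
    MeasurableSet B →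
    P x (A ∩ X (s + t) ⁻¹' B) = ∫⁻ ω in A, P (X s ω) (X t ⁻¹' B) ∂(P x)

/-- The Markov process `(X, (P x)_{x ∈ 𝔇})` is affine, with `ν(t, u) ∈ ℂ` and `φ(t, u) ∈ ℂᵈ`:
`E (exp (i ⟨z, X_t⟩) | X₀ = x) = exp (ν(t, i z) + ⟨φ(t, i z), x⟩)`
for all `t ≥ 0`, `z ∈ ℝᵈ` and `x ∈ 𝔇`. -/
structure IsAffineProcess (𝔇 : Set (EuclideanSpace ℝ (Fin d)))
    (X : ℝ≥0 → Ω → EuclideanSpace ℝ (Fin d))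
    (P : EuclideanSpace ℝ (Fin d) → Measure Ω)
    (ν : ℝ → (Fin d → ℂ) → ℂ) (φ : ℝ → (Fin d → ℂ) → (Fin d → ℂ)) : Prop
    extends IsMarkovProcess 𝔇 X P where
  affine : ∀ (t : ℝ≥0) (z : EuclideanSpace ℝ (Fin d)), ∀ x ∈ 𝔇,
    ∫ ω, Complex.exp (Complex.I * pairing (vecC z) (vecC (X t ω))) ∂(P x) =
      Complex.exp (ν t (fun j => Complex.I * (z j : ℂ)) +
        pairing (φ t (fun j => Complex.I * (z j : ℂ))) (vecC x))

/-- `E (exp (i ⟨z + i η, X_t⟩) | X₀ = x)`, the (generalized) characteristic function at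
`z + i η`. -/
def charFunShifted (X : ℝ≥0 → Ω → EuclideanSpace ℝ (Fin d))
    (P : EuclideanSpace ℝ (Fin d) → Measure Ω) (t : ℝ) (x : EuclideanSpace ℝ (Fin d))
    (η z : EuclideanSpace ℝ (Fin d)) : ℂ :=
  ∫ ω, Complex.exp (pairing (shifted η z) (vecC (X t.toNNReal ω))) ∂(P x)

/-- `f̂(z - i η) = ∫ exp (i ⟨z, x⟩) exp ⟨η, x⟩ f(x) dx`. -/
def dampedFourier (f : EuclideanSpace ℝ (Fin d) → ℝ) (η z : EuclideanSpace ℝ (Fin d)) : ℂ :=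
  ∫ x, Complex.exp (Complex.I * ((inner ℝ z x : ℝ) : ℂ)) *
    ((Real.exp (inner ℝ η x) * f x : ℝ) : ℂ)

/-- The option price `E (f^{p¹} (X^{π'}_t) | X^{π'}_0 = x)` as a function of
`p = (p¹, t, x, π')`. -/
def price {m k : ℕ} (f : (Fin m → ℝ) → EuclideanSpace ℝ (Fin d) → ℝ)
    (X : (Fin k → ℝ) → ℝ≥0 → Ω → EuclideanSpace ℝ (Fin d))
    (P : (Fin k → ℝ) → EuclideanSpace ℝ (Fin d) → Measure Ω)
    (p : ParamIdx m d k → ℝ) : ℝ :=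
  ∫ ω, f (payoffPart p) (X (affinePart (modelPart p)) (timePart (modelPart p)).toNNReal ω)
    ∂(P (affinePart (modelPart p)) (WithLp.toLp 2 (statePart (modelPart p))))

/-- Condition (A1): `x ↦ exp ⟨η, x⟩ f^{p¹}(x)` is in `L¹(ℝᵈ)` for every `p¹ ∈ 𝒫¹`. -/
def CondA1 {m : ℕ} (f : (Fin m → ℝ) → EuclideanSpace ℝ (Fin d) → ℝ) (lo hi : Fin m → ℝ)
    (η : EuclideanSpace ℝ (Fin d)) : Prop :=
  ∀ p ∈ box lo hi, Integrable fun x => Real.exp (inner ℝ η x) * f p x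

/-- Condition (A2): for every `z ∈ ℝᵈ` the map `p¹ ↦ f̂^{p¹}(z - i η)` on `𝒫¹` extends
analytically to `B(𝒫¹, ϱ¹)`, and `|f̂^{p¹}(-z - i η)| ≤ c₁ exp (c₂ |z|)` for all
`p¹ ∈ B(𝒫¹, ϱ¹)` and `z ∈ ℝᵈ`. -/
def CondA2 {m : ℕ} (f : (Fin m → ℝ) → EuclideanSpace ℝ (Fin d) → ℝ) (lo hi ϱ : Fin m → ℝ)
    (η : EuclideanSpace ℝ (Fin d)) : Prop :=
  ∃ F : EuclideanSpace ℝ (Fin d) → (Fin m → ℂ) → ℂ,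
    (∀ z, AnalyticOn ℂ (F z) (genBernsteinEllipse lo hi ϱ)) ∧
    (∀ z, ∀ p ∈ box lo hi, F z (toComplex p) = dampedFourier (f p) η z) ∧
    ∃ c₁ c₂ : ℝ, 0 < c₁ ∧ 0 < c₂ ∧
      ∀ z, ∀ p ∈ genBernsteinEllipse lo hi ϱ, ‖F (-z) p‖ ≤ c₁ * Real.exp (c₂ * ‖z‖)

/-- Condition (A3): `E (exp (-⟨η, X^{p²}⟩)) < ∞` for every `p² = (t, x, π') ∈ 𝒫²`. -/
def CondA3 {k : ℕ} (X : (Fin k → ℝ) → ℝ≥0 → Ω → EuclideanSpace ℝ (Fin d))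
    (P : (Fin k → ℝ) → EuclideanSpace ℝ (Fin d) → Measure Ω) (lo hi : ModelIdx d k → ℝ)
    (η : EuclideanSpace ℝ (Fin d)) : Prop :=
  ∀ q ∈ box lo hi, Integrable
    (fun ω => Real.exp (-(inner ℝ η (X (affinePart q) (timePart q).toNNReal ω))))
    (P (affinePart q) (WithLp.toLp 2 (statePart q)))

end Affine

end ChebAffine

end

namespace ChebAffine

/-! By Fourier inversion the price is an integral over `w`, with `z = 2πw`, of the damped payoff
transform at `-z` times the generalized characteristic function at `z + iη`. By (A2), (i) and (ii)
each integrand extends, as a function of the parameters, to a separately holomorphic function on a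
product of Bernstein ellipses. By (A2) and (iii) it is bounded there by a constant times `exp (c₂‖z‖
- C₂‖z‖^α)`, which is integrable because `α > 1`. Interpolation is a finite linear combination of
point values, so it commutes with the integral over `w`. It therefore suffices to bound the
interpolation error of each integrand and integrate the bound; holomorphy of the price itself is
never needed.

In one variable (`norm_sub_interp_le`), `f ∘ joukowski` is holomorphic on an annulus, and moving the
circle of integration makes the Fourier coefficients of `f (cos θ)` decay geometrically. This gives
a Chebyshev series. Interpolation of degree `N` reproduces `T_l` for `l ≤ N` and sends every other
`T_l` to some `T_l'` with `l' ≤ N` (aliasing), so each tail term contributes at most twice its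
coefficient, and no Lebesgue constant enters.

In several variables (`SepHolo.norm_sub_sum_le`), the tensorized interpolation is a composition of
coordinate interpolations. Each preserves separate holomorphy and enlarges the sup bound by a factor
independent of the degrees, so the one-dimensional errors telescope.

The Fourier representation (`expectation_eq_integral_fourier`) has to hold for payoffs that are
merely integrable after damping. It rests on the fact that a finite measure with integrable
characteristic function has a bounded continuous density (`integrable_and_integral_eq_of_charFun`),
applied to the law of the process weighted by `exp (-⟨η, y⟩)`. Finiteness of the prices follows from
the same fact. -/

/-! ### One-dimensional Chebyshev interpolation -/

/-- The weight of the value at the `k`-th node in the interpolant of degree `N` at `s`. -/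
noncomputable def interpWeight (N k : ℕ) (s : ℝ) : ℝ :=
  ∑ j ∈ Finset.range (N + 1),
    chebFactor N j * chebWeight N k * Real.cos (j * Real.pi * (k / N)) * chebT j s

theorem abs_chebT_le (j : ℕ) (s : ℝ) : |chebT j s| ≤ 1 := Real.abs_cos_le_one _

theorem chebNode_mem (N k : ℕ) : chebNode N k ∈ Set.Icc (-1 : ℝ) 1 :=
  ⟨Real.neg_one_le_cos _, Real.cos_le_one _⟩

/-- The sum telescopes: `2 sin (θ/2) cos (kθ) = sin (kθ + θ/2) - sin (kθ - θ/2)`. -/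
theorem two_mul_sin_mul_sum_cos (θ : ℝ) (n : ℕ) :
    2 * Real.sin (θ / 2) * ∑ k ∈ Finset.range n, Real.cos (k * θ) =
      Real.sin (n * θ - θ / 2) + Real.sin (θ / 2) := by
  induction n with
  | zero => simp
  | succ n ih =>
    rw [Finset.sum_range_succ, mul_add, ih]
    have h1 : ((n + 1 : ℕ) : ℝ) * θ - θ / 2 = n * θ + θ / 2 := by push_cast; ring
    rw [h1, Real.sin_sub, Real.sin_add]
    ring

theorem sum_chebWeight {N : ℕ} (hN : 0 < N) (g : ℕ → ℝ) :
    ∑ k ∈ Finset.range (N + 1), chebWeight N k * g k =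
      ∑ k ∈ Finset.range N, g k - g 0 / 2 + g N / 2 := by
  obtain ⟨n, rfl⟩ : ∃ n, N = n + 1 := ⟨N - 1, by omega⟩
  rw [Finset.sum_range_succ, Finset.sum_range_succ', Finset.sum_range_succ']
  have h : ∑ k ∈ Finset.range n, chebWeight (n + 1) (k + 1) * g (k + 1) =
      ∑ k ∈ Finset.range n, g (k + 1) := by
    refine Finset.sum_congr rfl fun k hk => ?_
    have : k ≠ n := (Finset.mem_range.1 hk).ne
    simp [chebWeight, this]
  rw [h]
  simp [chebWeight]
  ring

/-- Discrete orthogonality of the cosines. -/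
theorem sum_chebWeight_cos {N : ℕ} (hN : 0 < N) (a : ℤ) :
    ∑ k ∈ Finset.range (N + 1), chebWeight N k * Real.cos (a * Real.pi * (k / N)) =
      if (2 * N : ℤ) ∣ a then (N : ℝ) else 0 := by
  have hN' : (N : ℝ) ≠ 0 := by positivity
  rw [sum_chebWeight hN]
  split_ifs with h
  · obtain ⟨c, rfl⟩ := h
    have h1 : ∀ k : ℕ, Real.cos (((2 * N * c : ℤ) : ℝ) * Real.pi * (k / N)) = 1 := fun k => by
      have : ((2 * N * c : ℤ) : ℝ) * Real.pi * (k / N) = ((c * k : ℤ) : ℝ) * (2 * Real.pi) := by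
        push_cast; field_simp
      rw [this, Real.cos_int_mul_two_pi]
    simp only [h1]
    simp
  · set θ : ℝ := a * Real.pi / N with hθ
    have h1 : ∀ k : ℕ, (a : ℝ) * Real.pi * (k / N) = k * θ := fun k => by rw [hθ]; ring
    have h2 : (N : ℝ) * θ = a * Real.pi := by rw [hθ]; field_simp
    -- `θ / 2 = aπ / (2N)` is a multiple of `π` exactly when `2N ∣ a`. Since `sin (Nθ) = 0`, the
    -- telescoped sum is `(1 - cos (Nθ)) / 2`, and halving the two end terms cancels it.
    have hs : Real.sin (θ / 2) ≠ 0 := by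
      rw [Ne, Real.sin_eq_zero_iff]
      rintro ⟨c, hc⟩
      apply h
      refine ⟨c, ?_⟩
      have h3 : (a : ℝ) * Real.pi = (2 * N * c : ℝ) * Real.pi := by
        rw [← h2]; linear_combination (-2 * N : ℝ) * hc
      exact_mod_cast mul_right_cancel₀ Real.pi_ne_zero h3
    simp only [h1]
    have h4 := two_mul_sin_mul_sum_cos θ N
    have h5 : Real.sin (N * θ) = 0 := by rw [h2]; exact Real.sin_int_mul_pi a
    rw [Real.sin_sub, h5] at h4
    apply mul_left_cancel₀ (mul_ne_zero two_ne_zero hs)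
    rw [mul_add, mul_sub, h4]
    simp
    ring

/-- Interpolation of degree `N` reproduces the Chebyshev polynomials of degree at most `N`. -/
theorem interp_cos_of_le {N l : ℕ} (hl : l ≤ N) (s : ℝ) :
    ∑ k ∈ Finset.range (N + 1), interpWeight N k s * Real.cos (l * Real.pi * (k / N)) =
      chebT l s := by
  rcases Nat.eq_zero_or_pos N with rfl | hN
  · obtain rfl : l = 0 := by omega
    simp [interpWeight, chebFactor, chebWeight, chebT]
  have hN' : (N : ℝ) ≠ 0 := by positivity
  -- Product-to-sum formula, followed by discrete orthogonality at the frequencies `j + l` and `j -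
  -- l`.
  have key : ∀ j : ℕ, ∑ k ∈ Finset.range (N + 1), chebWeight N k *
      (Real.cos (j * Real.pi * (k / N)) * Real.cos (l * Real.pi * (k / N))) =
      ((if (2 * N : ℤ) ∣ (j + l : ℤ) then (N : ℝ) else 0) +
        if (2 * N : ℤ) ∣ (j - l : ℤ) then (N : ℝ) else 0) / 2 := fun j => by
    rw [← sum_chebWeight_cos hN, ← sum_chebWeight_cos hN, ← Finset.sum_add_distrib,
      Finset.sum_div]
    refine Finset.sum_congr rfl fun k _ => ?_
    push_cast
    rw [add_mul, add_mul, sub_mul, sub_mul, Real.cos_add, Real.cos_sub]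
    ring
  have h1 : ∑ k ∈ Finset.range (N + 1), interpWeight N k s * Real.cos (l * Real.pi * (k / N)) =
      ∑ j ∈ Finset.range (N + 1), chebFactor N j * chebT j s *
        (((if (2 * N : ℤ) ∣ (j + l : ℤ) then (N : ℝ) else 0) +
        if (2 * N : ℤ) ∣ (j - l : ℤ) then (N : ℝ) else 0) / 2) := by
    simp_rw [interpWeight, Finset.sum_mul]
    rw [Finset.sum_comm]
    refine Finset.sum_congr rfl fun j _ => ?_
    rw [← key, Finset.mul_sum]
    exact Finset.sum_congr rfl fun k _ => by ring
  have hdvd : ∀ j : ℕ, j ≤ N → (((2 * N : ℤ) ∣ (j + l : ℤ)) ↔ (j = l ∧ (l = 0 ∨ l = N))) := by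
    intro j hj
    constructor
    · rintro ⟨c, hc⟩
      have hc0 : 0 ≤ c := by
        by_contra! h
        nlinarith
      have hc1 : c ≤ 1 := by
        by_contra! h
        nlinarith
      interval_cases c <;> omega
    · rintro ⟨rfl, rfl | rfl⟩
      · simp
      · exact ⟨1, by ring⟩
  have hdvd' : ∀ j : ℕ, j ≤ N → (((2 * N : ℤ) ∣ (j - l : ℤ)) ↔ j = l) := by
    intro j hj
    constructor
    · rintro ⟨c, hc⟩
      have hc0 : -1 < c := by
        by_contra! h
        nlinarith
      have hc1 : c < 1 := by
        by_contra! h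
        nlinarith
      obtain rfl : c = 0 := by omega
      omega
    · rintro rfl
      simp
  rw [h1, Finset.sum_eq_single l]
  -- For `l = 0` and `l = N` both divisibilities hold and the sum is `N`; for `0 < l < N` only the
  -- second holds and it is `N / 2`. `chebFactor` is the reciprocal in each case.
  · rw [if_congr (hdvd l hl) rfl rfl, if_congr (hdvd' l hl) rfl rfl, chebFactor]
    by_cases h0 : l = 0
    · subst h0
      simp [hN.ne']
      field_simp
    · by_cases h2 : l = N
      · subst h2
        simp [h0]
        field_simp
      · have h3 : 0 < l ∧ l < N := by omega
        simp only [if_neg hN.ne', if_pos h3, h0, h2, or_self, and_false, if_false, if_true]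
        field_simp
        ring
  · intro j hj hjl
    have hj' : j ≤ N := by
      have := Finset.mem_range.1 hj
      omega
    simp [hdvd j hj', hdvd' j hj', hjl]
  · intro h
    exact absurd (Finset.mem_range.2 (by omega)) h

/-- The interpolant of a Chebyshev polynomial of any degree is bounded by `1`, as it is again a
Chebyshev polynomial. -/
theorem abs_interp_cos_le (N l : ℕ) (s : ℝ) :
    |∑ k ∈ Finset.range (N + 1), interpWeight N k s * Real.cos (l * Real.pi * (k / N))| ≤ 1 := by
  rcases Nat.eq_zero_or_pos N with rfl | hN
  · simp [interpWeight, chebFactor, chebWeight, chebT]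
  have hN' : (N : ℝ) ≠ 0 := by positivity
  -- Aliasing: on the nodes `cos (lθ)` depends only on `l` modulo `2N` and up to sign, so `l` can be
  -- reduced to `[0, N]`, by reflection if the remainder exceeds `N`.
  obtain ⟨l', hl', h⟩ : ∃ l' ≤ N, ∀ k : ℕ,
      Real.cos (l * Real.pi * (k / N)) = Real.cos (l' * Real.pi * (k / N)) := by
    have hmod : l % (2 * N) < 2 * N := Nat.mod_lt _ (by omega)
    have hdm : (l : ℝ) = 2 * N * (l / (2 * N) : ℕ) + (l % (2 * N) : ℕ) := by
      exact_mod_cast (Nat.div_add_mod l (2 * N)).symm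
    by_cases hle : l % (2 * N) ≤ N
    · refine ⟨l % (2 * N), hle, fun k => ?_⟩
      rw [← Real.cos_add_nat_mul_two_pi ((l % (2 * N) : ℕ) * Real.pi * (k / N))
        (l / (2 * N) * k)]
      congr 1
      rw [hdm]
      push_cast
      field_simp
      ring
    · refine ⟨2 * N - l % (2 * N), by omega, fun k => ?_⟩
      rw [← Real.cos_neg, ← Real.cos_add_nat_mul_two_pi _ ((l / (2 * N) + 1) * k)]
      congr 1
      rw [Nat.cast_sub hmod.le, hdm]
      push_cast
      field_simp
      ring
  simp only [h]
  rw [interp_cos_of_le hl']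
  exact abs_chebT_le _ _

/-! ### Chebyshev expansions of holomorphic functions on a Bernstein ellipse -/

/-- The Joukowski map, which takes the annulus `ϱ⁻¹ < |u| < ϱ` onto the Bernstein ellipse. -/
noncomputable def joukowski (u : ℂ) : ℂ := (u + u⁻¹) / 2

theorem joukowski_exp (θ : ℝ) :
    joukowski (Complex.exp (θ * Complex.I)) = ((Real.cos θ : ℝ) : ℂ) := by
  rw [joukowski, ← Complex.exp_neg, Complex.ofReal_cos, Complex.cos, neg_mul]

/-- Both distances are squares, `|u ∓ 1|² / (2|u|)`, and the parallelogram law adds them up. -/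
theorem norm_joukowski_sub_one_add (u : ℂ) (hu : u ≠ 0) :
    ‖joukowski u - 1‖ + ‖joukowski u + 1‖ = ‖u‖ + ‖u‖⁻¹ := by
  have h1 : joukowski u - 1 = (u - 1) ^ 2 / (2 * u) := by rw [joukowski]; field_simp; ring
  have h2 : joukowski u + 1 = (u + 1) ^ 2 / (2 * u) := by rw [joukowski]; field_simp; ring
  have h3 : ‖u‖ ≠ 0 := norm_ne_zero_iff.2 hu
  have h4 := parallelogram_law_with_norm ℝ u 1
  rw [norm_one] at h4
  rw [h1, h2, norm_div, norm_div, norm_pow, norm_pow, norm_mul, Complex.norm_ofNat]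
  field_simp
  linarith

theorem add_inv_lt_add_inv {x ϱ : ℝ} (hϱ : 0 < ϱ) (h1 : ϱ⁻¹ < x) (h2 : x < ϱ) :
    x + x⁻¹ < ϱ + ϱ⁻¹ := by
  have hx : 0 < x := (inv_pos.2 hϱ).trans h1
  have h3 : 0 < ϱ * x - 1 := by
    have := mul_lt_mul_of_pos_left h1 hϱ
    rw [mul_inv_cancel₀ hϱ.ne'] at this
    linarith
  have h4 : ϱ + ϱ⁻¹ - (x + x⁻¹) = (ϱ - x) * (ϱ * x - 1) / (ϱ * x) := by field_simp; ring
  have h5 : 0 < (ϱ - x) * (ϱ * x - 1) / (ϱ * x) := by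
    have := sub_pos.2 h2
    positivity
  linarith

theorem joukowski_mem {ϱ : ℝ} (hϱ : 0 < ϱ) {u : ℂ} (h1 : ϱ⁻¹ < ‖u‖) (h2 : ‖u‖ < ϱ) :
    joukowski u ∈ bernsteinEllipse ϱ := by
  have hu : u ≠ 0 := norm_pos_iff.1 ((inv_pos.2 hϱ).trans h1)
  rw [bernsteinEllipse, Set.mem_ofPred_eq, norm_joukowski_sub_one_add u hu]
  exact add_inv_lt_add_inv hϱ h1 h2

theorem isOpen_bernsteinEllipse (ϱ : ℝ) : IsOpen (bernsteinEllipse ϱ) :=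
  isOpen_lt (by fun_prop) (by fun_prop)

theorem ofReal_mem_bernsteinEllipse {ϱ : ℝ} (hϱ : 1 < ϱ) {s : ℝ} (hs : s ∈ Set.Icc (-1 : ℝ) 1) :
    (s : ℂ) ∈ bernsteinEllipse ϱ := by
  have h : ((s : ℂ)) = joukowski (Complex.exp (Real.arccos s * Complex.I)) := by
    rw [joukowski_exp, Real.cos_arccos hs.1 hs.2]
  rw [h]
  apply joukowski_mem (by linarith) <;> rw [Complex.norm_exp_ofReal_mul_I]
  exacts [inv_lt_one_of_one_lt₀ hϱ, hϱ]

theorem bernsteinEllipse_subset {r ϱ : ℝ} (hr : 1 < r) (h : r ≤ ϱ) :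
    bernsteinEllipse r ⊆ bernsteinEllipse ϱ := by
  rcases h.eq_or_lt with rfl | h
  · exact subset_rfl
  intro w hw
  rw [bernsteinEllipse, Set.mem_ofPred_eq] at hw ⊢
  have h1 : ϱ⁻¹ < r := (inv_lt_one_of_one_lt₀ (hr.trans h)).trans hr
  exact hw.trans (add_inv_lt_add_inv (by linarith) h1 h)

theorem differentiableAt_comp_joukowski {ϱ : ℝ} (hϱ : 0 < ϱ) {f : ℂ → ℂ}
    (hf : DifferentiableOn ℂ f (bernsteinEllipse ϱ)) {u : ℂ} (h1 : ϱ⁻¹ < ‖u‖) (h2 : ‖u‖ < ϱ) :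
    DifferentiableAt ℂ (fun u => f (joukowski u)) u := by
  have hu : u ≠ 0 := norm_pos_iff.1 ((inv_pos.2 hϱ).trans h1)
  have h3 : DifferentiableAt ℂ f (joukowski u) :=
    hf.differentiableAt ((isOpen_bernsteinEllipse ϱ).mem_nhds (joukowski_mem hϱ h1 h2))
  have h4 : DifferentiableAt ℂ joukowski u :=
    (differentiableAt_id.add (differentiableAt_inv hu)).div_const 2
  exact DifferentiableAt.comp (f := joukowski) u h3 h4

/-- The Fourier coefficients of `θ ↦ f (cos θ)` can be computed on any circle in the annulus on
which `f ∘ joukowski` is holomorphic. -/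
theorem circleIntegral_joukowski_eq {ϱ : ℝ} {f : ℂ → ℂ}
    (hf : DifferentiableOn ℂ f (bernsteinEllipse ϱ)) {r R : ℝ} (h1 : ϱ⁻¹ < r) (hrR : r ≤ R)
    (h2 : R < ϱ) (hr : 0 < r) (n : ℤ) :
    (∮ z in C(0, R), z⁻¹ * (z ^ (-n) * f (joukowski z))) =
      ∮ z in C(0, r), z⁻¹ * (z ^ (-n) * f (joukowski z)) := by
  have hd : ∀ z : ℂ, r ≤ ‖z‖ → ‖z‖ ≤ R →
      DifferentiableAt ℂ (fun z => z ^ (-n) * f (joukowski z)) z := fun z hz1 hz2 => by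
    have hz : z ≠ 0 := norm_pos_iff.1 (by linarith)
    exact (differentiableAt_zpow.2 (Or.inl hz)).mul
      (differentiableAt_comp_joukowski (by linarith) hf (by linarith) (by linarith))
  have := Complex.circleIntegral_sub_center_inv_smul_eq_of_differentiable_on_annulus_off_countable
    (c := 0) hr hrR (f := fun z => z ^ (-n) * f (joukowski z)) Set.countable_empty
    (fun z hz => (hd z (by simpa using hz.2) (by simpa using hz.1)).continuousAt.continuousWithinAt)
    (fun z hz => hd z (by have := hz.1.2; simp at this; linarith)
      (by have := hz.1.1; simp at this; linarith))
  simpa using this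

theorem norm_circleIntegral_joukowski_le {ϱ V : ℝ} {f : ℂ → ℂ}
    (hV : ∀ w ∈ bernsteinEllipse ϱ, ‖f w‖ ≤ V) {R : ℝ} (h1 : ϱ⁻¹ < R)
    (h2 : R < ϱ) (hR : 0 < R) (n : ℤ) :
    ‖∮ z in C(0, R), z⁻¹ * (z ^ (-n) * f (joukowski z))‖ ≤ 2 * Real.pi * (R ^ (-n) * V) := by
  have h := circleIntegral.norm_integral_le_of_norm_le_const (c := 0) (R := R)
    (f := fun z => z⁻¹ * (z ^ (-n) * f (joukowski z))) (C := R⁻¹ * (R ^ (-n) * V)) hR.le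
    (fun z hz => by
      have hz' : ‖z‖ = R := by simpa using hz
      rw [norm_mul, norm_mul, norm_inv, norm_zpow, hz']
      have := hV _ (joukowski_mem (by linarith) (by rwa [hz']) (by rwa [hz']))
      gcongr)
  refine h.trans (le_of_eq ?_)
  field_simp

/-- The circle is moved outwards to radius `R` for `n ≥ 0` and inwards to `R⁻¹` for `n ≤ 0`; in both
cases `|z ^ (-n)|` becomes `R⁻¹ ^ |n|`. -/
theorem norm_circleIntegral_unit_joukowski_le {ϱ V : ℝ} {f : ℂ → ℂ}
    (hf : DifferentiableOn ℂ f (bernsteinEllipse ϱ))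
    (hV : ∀ w ∈ bernsteinEllipse ϱ, ‖f w‖ ≤ V) {R : ℝ} (hR : 1 < R) (h2 : R < ϱ) (n : ℤ) :
    ‖∮ z in C(0, 1), z⁻¹ * (z ^ (-n) * f (joukowski z))‖ ≤
      2 * Real.pi * (V * R⁻¹ ^ n.natAbs) := by
  have h3 : ϱ⁻¹ < R⁻¹ := inv_strictAnti₀ (by linarith) h2
  have h4 : R⁻¹ < 1 := inv_lt_one_of_one_lt₀ hR
  rcases le_total 0 n with hn | hn
  · rw [← circleIntegral_joukowski_eq hf (R := R) (by linarith) hR.le h2 one_pos]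
    refine (norm_circleIntegral_joukowski_le hV (by linarith) h2 (by linarith) n).trans
      (le_of_eq ?_)
    lift n to ℕ using hn
    simp [mul_comm]
  · rw [circleIntegral_joukowski_eq hf h3 h4.le (by linarith) (by positivity)]
    refine (norm_circleIntegral_joukowski_le hV h3 (by linarith) (by positivity) n).trans
      (le_of_eq ?_)
    obtain ⟨j, rfl⟩ : ∃ j : ℕ, n = -(j : ℤ) := ⟨n.natAbs, by omega⟩
    simp [mul_comm]

/-- A holomorphic function on a Bernstein ellipse has a Chebyshev expansion with geometrically
decaying coefficients. -/
theorem exists_hasSum_cos {ϱ V : ℝ} {f : ℂ → ℂ}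
    (hf : DifferentiableOn ℂ f (bernsteinEllipse ϱ))
    (hV : ∀ w ∈ bernsteinEllipse ϱ, ‖f w‖ ≤ V) {R : ℝ} (hR : 1 < R) (h2 : R < ϱ) :
    ∃ c : ℤ → ℂ, (∀ n, ‖c n‖ ≤ V * R⁻¹ ^ n.natAbs) ∧
      ∀ θ : ℝ, HasSum (fun n => c n * ((Real.cos (n.natAbs * θ) : ℝ) : ℂ))
        (f ((Real.cos θ : ℝ) : ℂ)) := by
  have : Fact (0 < 2 * Real.pi) := ⟨Real.two_pi_pos⟩
  have hcont : Continuous fun θ : ℝ => f ((Real.cos θ : ℝ) : ℂ) :=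
    hf.continuousOn.comp_continuous (by fun_prop) fun θ =>
      ofReal_mem_bernsteinEllipse (hR.trans h2) ⟨Real.neg_one_le_cos _, Real.cos_le_one _⟩
  have hper : Function.Periodic (fun θ : ℝ => f ((Real.cos θ : ℝ) : ℂ)) (2 * Real.pi) :=
    fun θ => by simp only [Real.cos_add_two_pi]
  let F : C(AddCircle (2 * Real.pi), ℂ) := ⟨hper.lift, continuous_coinduced_dom.2 hcont⟩
  have hF : ∀ θ : ℝ, F (θ : AddCircle (2 * Real.pi)) = f ((Real.cos θ : ℝ) : ℂ) := fun θ => rfl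
  have hbound : ∀ n : ℤ, ‖fourierCoeff F n‖ ≤ V * R⁻¹ ^ n.natAbs := fun n => by
    have h := norm_circleIntegral_unit_joukowski_le hf hV hR h2 n
    -- With `z = e^{iθ}` one has `dz / z = i dθ`, so the contour integral is `2πi` times the Fourier
    -- coefficient.
    have h3 : (∮ z in C(0, 1), z⁻¹ * (z ^ (-n) * f (joukowski z))) =
        Complex.I * ∫ θ in (0 : ℝ)..0 + 2 * Real.pi,
          fourier (-n) (θ : AddCircle (2 * Real.pi)) • F (θ : AddCircle (2 * Real.pi)) := by
      rw [circleIntegral, ← intervalIntegral.integral_const_mul, zero_add]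
      refine intervalIntegral.integral_congr fun θ _ => ?_
      have h5 := joukowski_exp θ
      have h6 : Complex.exp (θ * Complex.I) ^ (-n) =
          fourier (-n) (θ : AddCircle (2 * Real.pi)) := by
        rw [fourier_coe_apply, ← Complex.exp_int_mul]
        congr 1
        push_cast
        have : (Real.pi : ℂ) ≠ 0 := by exact_mod_cast Real.pi_ne_zero
        field_simp
      simp only [deriv_circleMap, circleMap, hF, zero_add, Complex.ofReal_one, one_mul, h5, h6,
        smul_eq_mul]
      have h7 := Complex.exp_ne_zero (θ * Complex.I)
      field_simp
    rw [h3, norm_mul, Complex.norm_I, one_mul] at h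
    rw [fourierCoeff_eq_intervalIntegral F n 0, norm_smul]
    have h4 : ‖1 / (2 * Real.pi)‖ = (2 * Real.pi)⁻¹ := by
      rw [one_div, Real.norm_of_nonneg (by positivity)]
    rw [h4, inv_mul_le_iff₀ Real.two_pi_pos]
    exact h
  have hsum : Summable fun n : ℤ => V * R⁻¹ ^ n.natAbs := by
    apply Summable.mul_left
    have h := summable_geometric_of_lt_one (inv_nonneg.2 (zero_le_one.trans hR.le))
      (inv_lt_one_of_one_lt₀ hR)
    apply Summable.of_nat_of_neg <;> simpa using h
  have hs : Summable (fourierCoeff F) := Summable.of_norm_bounded hsum hbound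
  refine ⟨fourierCoeff F, hbound, fun θ => ?_⟩
  have h1 := has_pointwise_sum_fourier_series_of_summable hs (θ : AddCircle (2 * Real.pi))
  -- `cos` is even, so averaging the Fourier series at `θ` and `-θ` turns the exponentials into
  -- cosines.
  have h3 := has_pointwise_sum_fourier_series_of_summable hs ((-θ : ℝ) : AddCircle (2 * Real.pi))
  rw [hF] at h1 h3
  rw [Real.cos_neg] at h3
  have h4 := (h1.add h3).div_const 2
  rw [add_self_div_two] at h4
  refine (congrArg (HasSum · _) (funext fun n => ?_)).mpr h4
  have h5 : (Real.cos (n.natAbs * θ) : ℝ) = Real.cos (n * θ) := by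
    rcases Int.natAbs_eq n with h | h
    · conv_rhs => rw [h]
      simp
    · conv_rhs => rw [h]
      simp
  have h6 : ∀ φ : ℝ, (fourier n (φ : AddCircle (2 * Real.pi)) : ℂ) =
      Complex.exp ((n * φ : ℝ) * Complex.I) := fun φ => by
    rw [fourier_coe_apply]
    congr 1
    push_cast
    have : (Real.pi : ℂ) ≠ 0 := by exact_mod_cast Real.pi_ne_zero
    field_simp
  rw [h5, h6, h6, Complex.ofReal_cos, Complex.cos, smul_eq_mul, smul_eq_mul]
  push_cast
  rw [mul_neg, neg_mul]
  ring

/-- Geometric convergence of Chebyshev interpolation in one variable. -/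
theorem norm_sub_interp_le {ϱ r V : ℝ} (hr : 1 < r) (hϱ : r ^ 2 < ϱ) {f : ℂ → ℂ}
    (hf : DifferentiableOn ℂ f (bernsteinEllipse ϱ))
    (hV : ∀ w ∈ bernsteinEllipse ϱ, ‖f w‖ ≤ V) (N : ℕ) {s : ℝ} (hs : s ∈ Set.Icc (-1 : ℝ) 1) :
    ‖f s - ∑ k ∈ Finset.range (N + 1), (interpWeight N k s : ℂ) * f (chebNode N k)‖ ≤
      (2 * ∑' n : ℤ, r⁻¹ ^ n.natAbs) * V * r⁻¹ ^ N := by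
  -- The coefficients decay like `(r ^ 2)⁻¹ ^ |n|`. For `|n| > N` one factor `r⁻¹ ^ |n|` yields the
  -- rate `r⁻¹ ^ N`; the other keeps the series summable.
  obtain ⟨c, hc, hsum⟩ := exists_hasSum_cos hf hV (one_lt_pow₀ hr two_ne_zero) hϱ
  have hr0 : 0 < r⁻¹ := inv_pos.2 (zero_lt_one.trans hr)
  have hr1 : r⁻¹ < 1 := inv_lt_one_of_one_lt₀ hr
  have hV0 : 0 ≤ V := (norm_nonneg _).trans (hV _ (ofReal_mem_bernsteinEllipse
    ((one_lt_pow₀ hr two_ne_zero).trans hϱ) hs))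
  have hgeo : Summable fun n : ℤ => r⁻¹ ^ n.natAbs := by
    have h := summable_geometric_of_lt_one hr0.le hr1
    apply Summable.of_nat_of_neg <;> simpa using h
  have h1 : HasSum (fun n : ℤ => c n * (chebT n.natAbs s : ℂ)) (f s) := by
    have := hsum (Real.arccos s)
    rwa [Real.cos_arccos hs.1 hs.2] at this
  have h2 : ∀ k : ℕ, HasSum (fun n : ℤ => c n *
      ((Real.cos (n.natAbs * Real.pi * (k / N)) : ℝ) : ℂ)) (f (chebNode N k)) := fun k => by
    simpa only [chebNode, mul_assoc] using hsum (Real.pi * (k / N))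
  have h3 := h1.sub (hasSum_sum (s := Finset.range (N + 1)) fun k _ =>
    (h2 k).mul_left (interpWeight N k s : ℂ))
  set e : ℤ → ℂ := fun n => c n * (chebT n.natAbs s : ℂ) - ∑ k ∈ Finset.range (N + 1),
    (interpWeight N k s : ℂ) * (c n * ((Real.cos (n.natAbs * Real.pi * (k / N)) : ℝ) : ℂ))
    with he
  have he' : ∀ n, e n = c n * ((chebT n.natAbs s - ∑ k ∈ Finset.range (N + 1),
      interpWeight N k s * Real.cos (n.natAbs * Real.pi * (k / N)) : ℝ) : ℂ) := fun n => by
    rw [he]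
    push_cast
    rw [mul_sub, Finset.mul_sum]
    congr 1
    exact Finset.sum_congr rfl fun k _ => by ring
  have hle : ∀ n, ‖e n‖ ≤ 2 * V * r⁻¹ ^ N * r⁻¹ ^ n.natAbs := fun n => by
    rw [he', norm_mul, Complex.norm_real, Real.norm_eq_abs]
    rcases le_or_gt n.natAbs N with hn | hn
    · rw [interp_cos_of_le hn, sub_self, abs_zero, mul_zero]
      positivity
    · have h4 := abs_sub (chebT n.natAbs s) (∑ k ∈ Finset.range (N + 1),
        interpWeight N k s * Real.cos (n.natAbs * Real.pi * (k / N)))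
      have h5 := abs_chebT_le n.natAbs s
      have h6 := abs_interp_cos_le N n.natAbs s
      calc ‖c n‖ * _ ≤ (V * (r ^ 2)⁻¹ ^ n.natAbs) * 2 :=
            mul_le_mul (hc n) (by linarith) (abs_nonneg _) (by positivity)
        _ = 2 * V * r⁻¹ ^ n.natAbs * r⁻¹ ^ n.natAbs := by
            rw [← inv_pow, ← pow_mul, two_mul, pow_add]; ring
        _ ≤ _ := by
            gcongr 2 * V * ?_ * _
            exact pow_le_pow_of_le_one hr0.le hr1.le hn.le
  have h7 := tsum_of_norm_bounded (hgeo.hasSum.mul_left (2 * V * r⁻¹ ^ N)) hle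
  rw [h3.tsum_eq] at h7
  refine h7.trans (le_of_eq (by ring))

/-! ### Tensorized Chebyshev interpolation -/

section Tensor

variable {ι : Type*} [DecidableEq ι]

theorem update_mem {ϱ : ℝ} {v : ι → ℂ} (hv : ∀ i, v i ∈ bernsteinEllipse ϱ) (i : ι) {w : ℂ}
    (hw : w ∈ bernsteinEllipse ϱ) (j : ι) : Function.update v i w j ∈ bernsteinEllipse ϱ := by
  by_cases h : j = i
  · subst h
    simpa using hw
  · simpa [h] using hv j

/-- Swapping the sums over `j` and `k` lets the sum over `j` factor into a product of
one-dimensional weights. -/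
theorem chebInterpUnit_eq_sum [Fintype ι] (N : ι → ℕ) (g : (ι → ℝ) → ℝ) (q : ι → ℝ) :
    chebInterpUnit N g q = ∑ k ∈ multiIdx N,
      (∏ i, interpWeight (N i) (k i) (q i)) * g (fun i => chebNode (N i) (k i)) := by
  simp only [chebInterpUnit, chebCoeff, Finset.mul_sum, Finset.sum_mul]
  rw [Finset.sum_comm]
  refine Finset.sum_congr rfl fun k _ => ?_
  simp only [interpWeight]
  rw [Finset.prod_univ_sum, Finset.sum_mul]
  refine Finset.sum_congr rfl fun j _ => ?_
  simp only [Finset.prod_mul_distrib]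
  ring

/-- Interpolation in the `i`-th coordinate, evaluated at `q i`. -/
noncomputable def coordInterp (N : ι → ℕ) (q : ι → ℝ) (i : ι) (H : (ι → ℂ) → ℂ) (v : ι → ℂ) : ℂ :=
  ∑ k ∈ Finset.range (N i + 1),
    (interpWeight (N i) k (q i) : ℂ) * H (Function.update v i (chebNode (N i) k))

/-- Successive interpolation in the coordinates of a list. -/
noncomputable def listInterp (N : ι → ℕ) (q : ι → ℝ) (l : List ι) (H : (ι → ℂ) → ℂ) :
    (ι → ℂ) → ℂ :=
  l.foldr (coordInterp N q) H

/-- Coordinates outside `l` carry the dummy index `0`, so that all partial interpolants are sums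
over the same type of multi-indices and an induction on `l` is possible. -/
theorem listInterp_eq_sum [Fintype ι] (N : ι → ℕ) (q : ι → ℝ) (H : (ι → ℂ) → ℂ) (l : List ι)
    (hl : l.Nodup) (v : ι → ℂ) :
    listInterp N q l H v =
      ∑ k ∈ Fintype.piFinset (fun i => if i ∈ l then Finset.range (N i + 1) else {0}),
        (∏ i ∈ l.toFinset, (interpWeight (N i) (k i) (q i) : ℂ)) *
          H (fun i => if i ∈ l then (chebNode (N i) (k i) : ℂ) else v i) := by
  induction l generalizing v with
  | nil => simp [listInterp]
  | cons a l ih =>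
    obtain ⟨ha, hl⟩ := List.nodup_cons.1 hl
    have hstep : listInterp N q (a :: l) H v =
        coordInterp N q a (listInterp N q l H) v := rfl
    rw [hstep, coordInterp]
    -- The sum for `a :: l` is split by the value `m` of the index at `a`; resetting that value to
    -- the dummy `0` identifies each fibre with the index set for `l`.
    refine Eq.trans ?_ (Finset.sum_fiberwise_of_maps_to (g := fun k : ι → ℕ => k a)
      (t := Finset.range (N a + 1))
      (fun k hk => by simpa using Fintype.mem_piFinset.1 hk a) _)
    refine Finset.sum_congr rfl fun m hm => ?_
    rw [ih hl, Finset.mul_sum]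
    refine Finset.sum_nbij' (fun k => Function.update k a m) (fun k => Function.update k a 0)
      ?_ ?_ ?_ ?_ ?_
    · intro k hk
      rw [Fintype.mem_piFinset] at hk
      rw [Finset.mem_filter, Fintype.mem_piFinset]
      refine ⟨fun i => ?_, by simp⟩
      by_cases hi : i = a
      · subst hi
        simpa using hm
      · simpa [hi] using hk i
    · intro k hk
      rw [Finset.mem_filter, Fintype.mem_piFinset] at hk
      rw [Fintype.mem_piFinset]
      intro i
      by_cases hi : i = a
      · subst hi
        simp [ha]
      · simpa [hi] using hk.1 i
    · intro k hk
      have := Fintype.mem_piFinset.1 hk a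
      simp only [ha, if_false, Finset.mem_singleton] at this
      rw [Function.update_idem, ← this, Function.update_eq_self]
    · intro k hk
      have := (Finset.mem_filter.1 hk).2
      rw [Function.update_idem, ← this, Function.update_eq_self]
    · intro k _
      rw [List.toFinset_cons, Finset.prod_insert (by simpa using ha), Function.update_self,
        mul_assoc]
      congr 2
      · refine Finset.prod_congr rfl fun i hi => ?_
        have : i ≠ a := by
          rintro rfl
          exact ha (List.mem_toFinset.1 hi)
        rw [Function.update_of_ne this]
      · congr 1
        funext i
        by_cases hi : i = a
        · subst hi
          simp [ha]
        · simp [hi]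

theorem listInterp_univ [Fintype ι] (N : ι → ℕ) (q : ι → ℝ) (H : (ι → ℂ) → ℂ) (v : ι → ℂ) :
    listInterp N q Finset.univ.toList H v = ∑ k ∈ multiIdx N,
      ((∏ i, interpWeight (N i) (k i) (q i) : ℝ) : ℂ) *
        H (fun i => (chebNode (N i) (k i) : ℂ)) := by
  rw [listInterp_eq_sum _ _ _ _ (Finset.nodup_toList _)]
  simp [multiIdx]

/-- Separately holomorphic functions on a product of Bernstein ellipses that are bounded by `V`. -/
structure SepHolo (ϱ V : ℝ) (H : (ι → ℂ) → ℂ) : Prop where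
  diff : ∀ v : ι → ℂ, (∀ i, v i ∈ bernsteinEllipse ϱ) → ∀ i,
    DifferentiableOn ℂ (fun w => H (Function.update v i w)) (bernsteinEllipse ϱ)
  bound : ∀ v : ι → ℂ, (∀ i, v i ∈ bernsteinEllipse ϱ) → ‖H v‖ ≤ V

/-- The constant in the error bound for interpolation in one variable. -/
noncomputable def interpConst (r : ℝ) : ℝ := 2 * ∑' n : ℤ, r⁻¹ ^ n.natAbs

theorem interpConst_nonneg {r : ℝ} (hr : 1 < r) : 0 ≤ interpConst r :=
  mul_nonneg zero_le_two (tsum_nonneg fun _ =>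
    pow_nonneg (inv_nonneg.2 (zero_le_one.trans hr.le)) _)

theorem SepHolo.norm_sub_coordInterp_le {ϱ r V : ℝ} (hr : 1 < r) (hϱ : r ^ 2 < ϱ)
    {H : (ι → ℂ) → ℂ} (hH : SepHolo ϱ V H) (N : ι → ℕ) {q : ι → ℝ}
    (hq : ∀ i, q i ∈ Set.Icc (-1 : ℝ) 1) (i : ι) {v : ι → ℂ}
    (hv : ∀ i, v i ∈ bernsteinEllipse ϱ) :
    ‖H (Function.update v i (q i)) - coordInterp N q i H v‖ ≤
      interpConst r * V * r⁻¹ ^ N i :=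
  norm_sub_interp_le hr hϱ (hH.diff v hv i)
    (fun _ hw => hH.bound _ (update_mem hv i hw)) (N i) (hq i)

/-- The interpolant differs from `H` with `q i` inserted by at most the one-dimensional error,
itself at most `interpConst r * V`. Hence the new bound does not depend on `N`, and the step can be
iterated. -/
theorem SepHolo.coordInterp {ϱ r V : ℝ} (hr : 1 < r) (hϱ : r ^ 2 < ϱ)
    {H : (ι → ℂ) → ℂ} (hH : SepHolo ϱ V H) (N : ι → ℕ) {q : ι → ℝ}
    (hq : ∀ i, q i ∈ Set.Icc (-1 : ℝ) 1) (i : ι) :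
    SepHolo ϱ ((1 + interpConst r) * V) (coordInterp N q i H) := by
  have hϱ1 : 1 < ϱ := (one_lt_pow₀ hr two_ne_zero).trans hϱ
  constructor
  · intro v hv j
    simp only [ChebAffine.coordInterp]
    refine DifferentiableOn.fun_sum fun k _ => DifferentiableOn.const_mul ?_ _
    by_cases hij : j = i
    · subst hij
      simp only [Function.update_idem]
      exact differentiableOn_const _
    · simp only [Function.update_comm hij]
      exact hH.diff _ (update_mem hv i (ofReal_mem_bernsteinEllipse hϱ1 (chebNode_mem _ _))) j
  · intro v hv
    have h1 := hH.norm_sub_coordInterp_le hr hϱ N hq i hv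
    have h2 := hH.bound _ (update_mem hv i (ofReal_mem_bernsteinEllipse hϱ1 (hq i)))
    have hV : 0 ≤ V := (norm_nonneg _).trans h2
    have h3 : r⁻¹ ^ N i ≤ 1 := pow_le_one₀ (inv_nonneg.2 (by linarith))
      (inv_le_one_of_one_le₀ hr.le)
    have h4 := mul_le_mul_of_nonneg_left h3 (mul_nonneg (interpConst_nonneg hr) hV)
    have h5 := norm_sub_norm_le (ChebAffine.coordInterp N q i H v) (H (Function.update v i (q i)))
    rw [norm_sub_rev] at h5
    linarith

theorem SepHolo.listInterp {ϱ r V : ℝ} (hr : 1 < r) (hϱ : r ^ 2 < ϱ)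
    {H : (ι → ℂ) → ℂ} (hH : SepHolo ϱ V H) (N : ι → ℕ) {q : ι → ℝ}
    (hq : ∀ i, q i ∈ Set.Icc (-1 : ℝ) 1) (l : List ι) :
    SepHolo ϱ ((1 + interpConst r) ^ l.length * V) (listInterp N q l H) := by
  induction l with
  | nil => simpa [ChebAffine.listInterp] using hH
  | cons a l ih =>
    have := ih.coordInterp hr hϱ N hq a
    rw [← mul_assoc, ← pow_succ'] at this
    exact this

/-- Telescoping over the coordinates: the one added after `l` costs `C (1 + C) ^ l.length * V * r⁻¹
^ n` with `C = interpConst r`, and these geometric terms sum to the stated constant. -/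
theorem SepHolo.norm_sub_listInterp_le {ϱ r V : ℝ} (hr : 1 < r) (hϱ : r ^ 2 < ϱ)
    {H : (ι → ℂ) → ℂ} (hH : SepHolo ϱ V H) (N : ι → ℕ) {q : ι → ℝ}
    (hq : ∀ i, q i ∈ Set.Icc (-1 : ℝ) 1) (n : ℕ) (hn : ∀ i, n ≤ N i) (l : List ι) :
    ‖H (toComplex q) - ChebAffine.listInterp N q l H (toComplex q)‖ ≤
      ((1 + interpConst r) ^ l.length - 1) * V * r⁻¹ ^ n := by
  have hϱ1 : 1 < ϱ := (one_lt_pow₀ hr two_ne_zero).trans hϱ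
  have hqm : ∀ i, toComplex q i ∈ bernsteinEllipse ϱ := fun i =>
    ofReal_mem_bernsteinEllipse hϱ1 (hq i)
  have hV : 0 ≤ V := (norm_nonneg _).trans (hH.bound _ hqm)
  have hC := interpConst_nonneg hr
  induction l with
  | nil => simp [ChebAffine.listInterp]
  | cons a l ih =>
    have h1 := (hH.listInterp hr hϱ N hq l).norm_sub_coordInterp_le hr hϱ N hq a hqm
    have h2 : Function.update (toComplex q) a (q a : ℂ) = toComplex q :=
      Function.update_eq_self a (toComplex q)
    rw [h2] at h1
    have h3 : r⁻¹ ^ N a ≤ r⁻¹ ^ n := pow_le_pow_of_le_one (inv_nonneg.2 (by linarith))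
      (inv_le_one_of_one_le₀ hr.le) (hn a)
    have h4 : interpConst r * ((1 + interpConst r) ^ l.length * V) * r⁻¹ ^ N a ≤
        interpConst r * ((1 + interpConst r) ^ l.length * V) * r⁻¹ ^ n :=
      mul_le_mul_of_nonneg_left h3 (by positivity)
    calc _ ≤ _ := norm_sub_le_norm_sub_add_norm_sub _
          (ChebAffine.listInterp N q l H (toComplex q)) _
      _ ≤ _ := add_le_add ih (h1.trans h4)
      _ = _ := by rw [List.length_cons, pow_succ]; ring

/-- Geometric convergence of tensorized Chebyshev interpolation. -/
theorem SepHolo.norm_sub_sum_le [Fintype ι] {ϱ r V : ℝ} (hr : 1 < r) (hϱ : r ^ 2 < ϱ)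
    {H : (ι → ℂ) → ℂ} (hH : SepHolo ϱ V H) (N : ι → ℕ) {q : ι → ℝ}
    (hq : ∀ i, q i ∈ Set.Icc (-1 : ℝ) 1) (n : ℕ) (hn : ∀ i, n ≤ N i) :
    ‖H (toComplex q) - ∑ k ∈ multiIdx N, ((∏ i, interpWeight (N i) (k i) (q i) : ℝ) : ℂ) *
        H (toComplex fun i => chebNode (N i) (k i))‖ ≤
      ((1 + interpConst r) ^ Fintype.card ι - 1) * V * r⁻¹ ^ n := by
  have := hH.norm_sub_listInterp_le hr hϱ N hq n hn Finset.univ.toList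
  rwa [listInterp_univ, Finset.length_toList, Finset.card_univ] at this

end Tensor

/-! ### Fourier inversion for finite measures -/

section Inversion

open scoped FourierTransform

/-- `charFun` uses the kernel `exp (i⟨x, t⟩)` and the Fourier integral `exp (-2πi L x w)`; this
accounts for the scaling by `2π` and for the form `-innerₗ E`. -/
theorem charFun_two_pi_smul {E : Type*} [NormedAddCommGroup E] [InnerProductSpace ℝ E]
    [MeasurableSpace E] (μ : Measure E) (w : E) :
    charFun μ ((2 * Real.pi) • w) =
      VectorFourier.fourierIntegral Real.fourierChar μ (-innerₗ E) (fun _ => (1 : ℂ)) w := by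
  rw [Real.vector_fourierIntegral_eq_integral_exp_smul, charFun_apply]
  congr 1
  funext x
  rw [inner_smul_right]
  simp

variable {E : Type*} [NormedAddCommGroup E] [InnerProductSpace ℝ E] [FiniteDimensional ℝ E]
  [MeasurableSpace E] [BorelSpace E] (μ : Measure E) [IsFiniteMeasure μ]

theorem integral_fourier_mul_eq {f g : E → ℂ} (hf : Integrable f) (hg : Integrable g) :
    ∫ w, 𝓕 f w * g w = ∫ x, f x * 𝓕 g x := by
  have h := VectorFourier.integral_fourierIntegral_smul_eq_flip (μ := volume) (ν := volume)
    (L := innerₗ E) (f := f) (g := g) Real.continuous_fourierChar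
    (by simpa using continuous_inner) hf hg
  rw [flip_innerₗ] at h
  exact h

theorem norm_fourier_le {g : E → ℂ} (x : E) : ‖𝓕 g x‖ ≤ ∫ y, ‖g y‖ :=
  VectorFourier.norm_fourierIntegral_le_integral_norm _ _ _ _ _

theorem continuous_fourier {g : E → ℂ} (hg : Integrable g) : Continuous (𝓕 g) :=
  VectorFourier.fourierIntegral_continuous Real.continuous_fourierChar
    (by simpa using continuous_inner) hg

/-- The integral of a test function in terms of the Fourier transform of the characteristic
function. -/
theorem integral_testFunction_eq (hψ : Integrable fun w => charFun μ ((2 * Real.pi) • w))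
    (φ : E → ℝ) (hφ : ContDiff ℝ (⊤ : ℕ∞) φ) (hc : HasCompactSupport φ) :
    ∫ x, (φ x : ℂ) ∂μ = ∫ x, (φ x : ℂ) * 𝓕 (fun w => charFun μ ((2 * Real.pi) • w)) x := by
  have hc' : HasCompactSupport fun x => (φ x : ℂ) := hc.comp_left (g := Complex.ofReal) rfl
  let s : SchwartzMap E ℂ := hc'.toSchwartzMap (Complex.ofRealCLM.contDiff.comp hφ)
  have hs : ∀ x, s x = (φ x : ℂ) := fun x => rfl
  -- Fubini between `μ` and Lebesgue measure, applied to `𝓕 s`, whose inverse transform is `s`. A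
  -- second exchange, `h4` below, moves the transform from `s` to the characteristic function.
  have h1 := VectorFourier.integral_fourierIntegral_smul_eq_flip (μ := μ) (ν := volume)
    (L := -innerₗ E) (f := fun _ => (1 : ℂ)) (g := ⇑(𝓕 s : SchwartzMap E ℂ))
    Real.continuous_fourierChar
    (by simpa [Pi.neg_def] using (continuous_inner (𝕜 := ℝ) (E := E)).fun_neg) (integrable_const _)
    (𝓕 s : SchwartzMap E ℂ).integrable
  have h2 : ∀ x, VectorFourier.fourierIntegral Real.fourierChar volume (-innerₗ E).flip
      ⇑(𝓕 s : SchwartzMap E ℂ) x =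
      s x := fun x => by
    have h3 : (𝓕⁻ (𝓕 s : SchwartzMap E ℂ) : SchwartzMap E ℂ) x = s x := by
      rw [FourierTransform.fourierInv_fourier_eq]
    rw [SchwartzMap.fourierInv_coe] at h3
    rw [← h3, Real.fourierInv_eq]
    simp [VectorFourier.fourierIntegral, real_inner_comm]
  simp only [h2, ← charFun_two_pi_smul, smul_eq_mul, one_mul, hs] at h1
  have h4 := integral_fourier_mul_eq s.integrable hψ
  simp only [hs] at h4
  rw [← h1, ← h4]
  simp only [SchwartzMap.fourier_coe, mul_comm]

/-- A finite measure with integrable characteristic function has a bounded density, given by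
Fourier inversion. -/
theorem integrable_and_integral_eq_of_charFun
    (hψ : Integrable fun w => charFun μ ((2 * Real.pi) • w)) {g : E → ℂ} (hg : Integrable g) :
    Integrable g μ ∧ ∫ x, g x ∂μ = ∫ w, 𝓕 g w * charFun μ ((2 * Real.pi) • w) := by
  set ψ : E → ℂ := fun w => charFun μ ((2 * Real.pi) • w) with hψd
  -- Absolute continuity of `μ` is not yet known, so `μ` and `volume` are compared through their
  -- densities with respect to a common dominating measure.
  set m : Measure E := μ + volume with hm
  have hμm : μ ≪ m := (Measure.le_add_right le_rfl).absolutelyContinuous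
  have hvm : (volume : Measure E) ≤ m := Measure.le_add_left le_rfl
  have hvm' : (volume : Measure E) ≪ m := hvm.absolutelyContinuous
  have hfin : IsFiniteMeasureOnCompacts m := ⟨fun K hK => by
    rw [hm, Measure.add_apply]
    exact ENNReal.add_lt_top.2 ⟨hK.measure_lt_top, hK.measure_lt_top⟩⟩
  have hloc : IsLocallyFiniteMeasure m := isLocallyFiniteMeasure_of_isFiniteMeasureOnCompacts
  have hcont := continuous_fourier hψ
  set M := ∫ y, ‖ψ y‖
  have hM : ∀ x, ‖𝓕 ψ x‖ ≤ M := fun x => norm_fourier_le x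
  -- `μ` has density `𝓕 ψ`, expressed through `m`: both sides are locally integrable and agree
  -- against all test functions.
  have key : ∀ᵐ x ∂m, (μ.rnDeriv m x).toReal • (1 : ℂ) =
      ((volume : Measure E).rnDeriv m x).toReal • 𝓕 ψ x := by
    refine ae_eq_of_integral_contDiff_smul_eq ?_ ?_ fun φ hφ hc => ?_
    · exact ((integrable_rnDeriv_smul_iff hμm).2 (integrable_const (1 : ℂ))).locallyIntegrable
    · refine LocallyIntegrable.mono (locallyIntegrable_const M)
        (((Measure.measurable_rnDeriv _ _).ennreal_toReal.aestronglyMeasurable).smul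
          hcont.aestronglyMeasurable) ?_
      filter_upwards [Measure.rnDeriv_le_one_of_le hvm] with x hx
      have h1 : ((volume : Measure E).rnDeriv m x).toReal ≤ 1 :=
        ENNReal.toReal_mono ENNReal.one_ne_top hx
      have hM0 : 0 ≤ M := (norm_nonneg _).trans (hM x)
      rw [norm_smul, Real.norm_of_nonneg ENNReal.toReal_nonneg, Real.norm_of_nonneg hM0]
      calc _ ≤ 1 * M := mul_le_mul h1 (hM x) (norm_nonneg _) zero_le_one
        _ = M := one_mul M
    · simp only [smul_comm (φ _)]
      rw [integral_rnDeriv_smul hμm, integral_rnDeriv_smul hvm']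
      have := integral_testFunction_eq μ hψ φ hφ hc
      simpa [Complex.real_smul] using this
  -- The identity of densities holds pointwise off an `m`-null set, so it may be multiplied by any
  -- `g`; no regularity of `g` is required.
  have key' : ∀ᵐ x ∂m, (μ.rnDeriv m x).toReal • g x =
      ((volume : Measure E).rnDeriv m x).toReal • (g x * 𝓕 ψ x) := by
    filter_upwards [key] with x hx
    rw [Complex.real_smul, mul_one] at hx
    rw [Complex.real_smul, hx, Complex.real_smul, Complex.real_smul]
    ring
  have hint : Integrable fun x => g x * 𝓕 ψ x :=
    hg.mul_bdd hcont.aestronglyMeasurable (Filter.Eventually.of_forall hM)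
  refine ⟨(integrable_rnDeriv_smul_iff hμm).1
    (((integrable_rnDeriv_smul_iff hvm').2 hint).congr (key'.mono fun x hx => hx.symm)), ?_⟩
  rw [← integral_rnDeriv_smul hμm, integral_congr_ae key', integral_rnDeriv_smul hvm',
    integral_fourier_mul_eq hg hψ]

end Inversion

/-! ### Integrability of the dominating function -/

theorem exists_sub_rpow_le {c b α : ℝ} (hb : 0 < b) (hα : 1 < α) :
    ∃ K : ℝ, ∀ r : ℝ, 0 ≤ r → c * r - b * r ^ α ≤ K - r := by
  obtain ⟨R, hR⟩ := Filter.eventually_atTop.1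
    ((tendsto_rpow_atTop (sub_pos.2 hα)).eventually_ge_atTop ((|c| + 1) / b))
  -- Beyond `R` one has `b * r ^ (α - 1) ≥ |c| + 1`, so the left side is at most `-r`; below `R` the
  -- constant absorbs `c * r + r`.
  refine ⟨(|c| + 1) * |R|, fun r hr => ?_⟩
  have hc := le_abs_self c
  rcases le_or_gt R r with h | h
  · have h1 := hR r h
    rw [div_le_iff₀ hb] at h1
    have h2 : r ^ α = r ^ (α - 1) * r := by
      rcases hr.eq_or_lt with rfl | hr
      · rw [mul_zero, Real.zero_rpow (by linarith)]
      · rw [← Real.rpow_add_one hr.ne', sub_add_cancel]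
    have h3 := mul_le_mul_of_nonneg_right h1 hr
    have h4 : 0 ≤ (|c| + 1) * |R| := by positivity
    have h5 := mul_le_mul_of_nonneg_right hc hr
    rw [h2]
    linarith
  · have h1 : r ≤ |R| := h.le.trans (le_abs_self R)
    have h2 := mul_le_mul_of_nonneg_left h1 (by positivity : 0 ≤ |c| + 1)
    have h3 : 0 ≤ b * r ^ α := mul_nonneg hb.le (Real.rpow_nonneg hr α)
    have h5 := mul_le_mul_of_nonneg_right hc hr
    linarith

section Integrability

variable {E : Type*} [NormedAddCommGroup E] [NormedSpace ℝ E] [FiniteDimensional ℝ E]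
  [MeasurableSpace E] [BorelSpace E] (μ : Measure E) [μ.IsAddHaarMeasure]

theorem integrable_exp_neg_norm : Integrable (fun x : E => Real.exp (-‖x‖)) μ := by
  set n := Module.finrank ℝ E + 1 with hn
  have h1 : Integrable (fun x : E => (1 + ‖x‖) ^ (-(n : ℝ))) μ :=
    integrable_one_add_norm (by rw [hn]; push_cast; linarith)
  refine (h1.const_mul (n.factorial * Real.exp 1)).mono' (by fun_prop)
    (Filter.Eventually.of_forall fun x => ?_)
  have h2 : 0 < 1 + ‖x‖ := by positivity
  -- The exponential series gives `exp (-‖x‖) ≤ n! e (1 + ‖x‖) ^ (-n)`, which is integrable for `n =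
  -- dim E + 1`.
  have h3 := Real.pow_div_factorial_le_exp (1 + ‖x‖) h2.le n
  rw [Real.norm_of_nonneg (Real.exp_pos _).le, Real.rpow_neg h2.le, Real.rpow_natCast,
    Real.exp_neg, ← div_eq_mul_inv, le_div_iff₀ (by positivity), inv_mul_le_iff₀ (Real.exp_pos _)]
  rw [div_le_iff₀ (by positivity), Real.exp_add] at h3
  linarith

theorem integrable_exp_sub_rpow (c : ℝ) {b α : ℝ} (hb : 0 < b) (hα : 1 < α) :
    Integrable (fun x : E => Real.exp (c * ‖x‖ - b * ‖x‖ ^ α)) μ := by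
  obtain ⟨K, hK⟩ := exists_sub_rpow_le (c := c) hb hα
  refine ((integrable_exp_neg_norm μ).const_mul (Real.exp K)).mono' ?_
    (Filter.Eventually.of_forall fun x => ?_)
  · have : Measurable fun x : E => Real.exp (c * ‖x‖ - b * ‖x‖ ^ α) := by fun_prop
    exact this.aestronglyMeasurable
  · rw [Real.norm_of_nonneg (Real.exp_pos _).le, ← Real.exp_add]
    exact Real.exp_le_exp.2 (hK _ (norm_nonneg _))

end Integrability

/-! ### Fourier representation of expectations -/

section Pricing

open scoped FourierTransform

variable {d : ℕ}

theorem pairing_shifted (η z x : EuclideanSpace ℝ (Fin d)) :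
    pairing (shifted η z) (vecC x) =
      ((inner ℝ x z : ℝ) : ℂ) * Complex.I + ((-(inner ℝ η x) : ℝ) : ℂ) := by
  simp only [pairing, shifted, vecC, PiLp.inner_apply, RCLike.inner_apply, conj_trivial]
  push_cast
  rw [Finset.sum_mul, ← Finset.sum_neg_distrib, ← Finset.sum_add_distrib]
  exact Finset.sum_congr rfl fun j _ => by ring

/-- The kernel `exp (-2πi⟨y, w⟩)` makes the payoff transform appear at `-2πw`, matching the sign in
(A2). -/
theorem fourier_damped (f : EuclideanSpace ℝ (Fin d) → ℝ) (η w : EuclideanSpace ℝ (Fin d)) :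
    𝓕 (fun y => ((Real.exp (inner ℝ η y) * f y : ℝ) : ℂ)) w =
      dampedFourier f η (-((2 * Real.pi) • w)) := by
  rw [Real.fourier_eq', dampedFourier]
  congr 1
  funext y
  rw [smul_eq_mul, inner_neg_left, inner_smul_left, real_inner_comm, conj_trivial]
  congr 2
  push_cast
  ring

variable {Ω : Type*} [MeasurableSpace Ω]

/-- The law of `Y`, damped by the density `exp (-⟨η, y⟩)`. -/
noncomputable def dampedLaw (Q : Measure Ω) (Y : Ω → EuclideanSpace ℝ (Fin d))
    (η : EuclideanSpace ℝ (Fin d)) : Measure (EuclideanSpace ℝ (Fin d)) :=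
  (Q.withDensity fun ω => ENNReal.ofReal (Real.exp (-(inner ℝ η (Y ω))))).map Y

theorem integral_dampedLaw {Q : Measure Ω} {Y : Ω → EuclideanSpace ℝ (Fin d)} (hY : Measurable Y)
    (η : EuclideanSpace ℝ (Fin d)) {g : EuclideanSpace ℝ (Fin d) → ℂ} (hg : Measurable g) :
    ∫ y, g y ∂(dampedLaw Q Y η) = ∫ ω, (Real.exp (-(inner ℝ η (Y ω)))) • g (Y ω) ∂Q := by
  rw [dampedLaw, integral_map hY.aemeasurable hg.aestronglyMeasurable,
    integral_withDensity_eq_integral_toReal_smul (by fun_prop) (by simp)]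
  simp only [ENNReal.toReal_ofReal (Real.exp_pos _).le]

theorem integrable_dampedLaw_iff {Q : Measure Ω} {Y : Ω → EuclideanSpace ℝ (Fin d)}
    (hY : Measurable Y) (η : EuclideanSpace ℝ (Fin d)) {g : EuclideanSpace ℝ (Fin d) → ℂ}
    (hg : Measurable g) :
    Integrable g (dampedLaw Q Y η) ↔
      Integrable (fun ω => (Real.exp (-(inner ℝ η (Y ω)))) • g (Y ω)) Q := by
  rw [dampedLaw, integrable_map_measure hg.aestronglyMeasurable hY.aemeasurable,
    integrable_withDensity_iff_integrable_smul' (by fun_prop) (by simp)]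
  simp only [ENNReal.toReal_ofReal (Real.exp_pos _).le, Function.comp_apply]

/-- The Fourier representation of the expectation of a payoff. -/
theorem expectation_eq_integral_fourier {Q : Measure Ω} {Y : Ω → EuclideanSpace ℝ (Fin d)}
    (hY : Measurable Y) {η : EuclideanSpace ℝ (Fin d)}
    (hη : Integrable (fun ω => Real.exp (-(inner ℝ η (Y ω)))) Q)
    {f : EuclideanSpace ℝ (Fin d) → ℝ} (hf : Measurable f)
    (hfη : Integrable fun y => Real.exp (inner ℝ η y) * f y)
    {B : EuclideanSpace ℝ (Fin d) → ℝ} (hB : Integrable B)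
    (hbound : ∀ w, ‖∫ ω, Complex.exp (pairing (shifted η ((2 * Real.pi) • w)) (vecC (Y ω))) ∂Q‖ ≤
      B w) :
    Integrable (fun ω => f (Y ω)) Q ∧
    Integrable (fun w => dampedFourier f η (-((2 * Real.pi) • w)) *
      ∫ ω, Complex.exp (pairing (shifted η ((2 * Real.pi) • w)) (vecC (Y ω))) ∂Q) ∧
    ((∫ ω, f (Y ω) ∂Q : ℝ) : ℂ) = ∫ w, dampedFourier f η (-((2 * Real.pi) • w)) *
      ∫ ω, Complex.exp (pairing (shifted η ((2 * Real.pi) • w)) (vecC (Y ω))) ∂Q := by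
  have hfin : IsFiniteMeasure (dampedLaw Q Y η) := by
    have := isFiniteMeasure_withDensity_ofReal hη.2
    exact Measure.isFiniteMeasure_map _ _
  -- Damping the law shifts the argument of the characteristic function by `iη`.
  have hchar : ∀ w, charFun (dampedLaw Q Y η) ((2 * Real.pi) • w) =
      ∫ ω, Complex.exp (pairing (shifted η ((2 * Real.pi) • w)) (vecC (Y ω))) ∂Q := fun w => by
    rw [charFun_apply, integral_dampedLaw hY η (by fun_prop)]
    congr 1
    funext ω
    rw [pairing_shifted, Complex.exp_add, Complex.real_smul, Complex.ofReal_exp, mul_comm]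
  have hψ : Integrable fun w => charFun (dampedLaw Q Y η) ((2 * Real.pi) • w) := by
    refine hB.mono' ?_ (Filter.Eventually.of_forall fun w => ?_)
    · exact (measurable_charFun.comp (measurable_const_smul _)).aestronglyMeasurable
    · rw [hchar]
      exact hbound w
  set g : EuclideanSpace ℝ (Fin d) → ℂ := fun y => ((Real.exp (inner ℝ η y) * f y : ℝ) : ℂ)
    with hg
  have hgm : Measurable g := by fun_prop
  have hgi : Integrable g := hfη.ofReal
  -- The weight of the damped law cancels the factor `exp ⟨η, y⟩` put on the payoff.
  have hcancel : ∀ ω, (Real.exp (-(inner ℝ η (Y ω)))) • g (Y ω) = ((f (Y ω) : ℝ) : ℂ) :=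
    fun ω => by
      rw [hg, Complex.real_smul, ← Complex.ofReal_mul, ← mul_assoc, ← Real.exp_add,
        neg_add_cancel, Real.exp_zero, one_mul]
  obtain ⟨h1, h2⟩ := integrable_and_integral_eq_of_charFun _ hψ hgi
  rw [integrable_dampedLaw_iff hY η hgm] at h1
  rw [integral_dampedLaw hY η hgm] at h2
  simp only [hcancel, integral_complex_ofReal, hchar] at h1 h2
  simp only [hg, fourier_damped] at h2
  refine ⟨by simpa using h1.re, ?_, h2⟩
  have h3 := hψ.bdd_mul (continuous_fourier hgi).aestronglyMeasurable
    (Filter.Eventually.of_forall fun x => norm_fourier_le x)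
  simpa only [hchar, hg, fourier_damped] using h3

end Pricing

/-! ### Affine transport to the unit cube -/

theorem ellipseMap_eq (a b : ℝ) (w : ℂ) :
    ellipseMap a b w = ((a + b) / 2 : ℂ) + ((b - a) / 2 : ℂ) * w := by
  have h1 : ((a + b) / 2 : ℂ) = (((a + b) / 2 : ℝ) : ℂ) := by push_cast; rfl
  have h2 : ((b - a) / 2 : ℂ) = (((b - a) / 2 : ℝ) : ℂ) := by push_cast; rfl
  rw [h1, h2]
  apply Complex.ext
  · simp only [ellipseMap, Complex.add_re, Complex.ofReal_re, Complex.re_ofReal_mul]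
    ring
  · simp only [ellipseMap, Complex.add_im, Complex.ofReal_im, Complex.im_ofReal_mul]
    ring

theorem ellipseMap_ofReal (a b s : ℝ) :
    ellipseMap a b s = ((b + (a - b) / 2 * (1 - s) : ℝ) : ℂ) := by
  rw [ellipseMap_eq]
  push_cast
  ring

section Cube

variable {ι : Type*}

/-- The affine map from a product of Bernstein ellipses to a generalized Bernstein ellipse. -/
noncomputable def ellipsePi (lo hi : ι → ℝ) (v : ι → ℂ) : ι → ℂ :=
  fun i => ellipseMap (lo i) (hi i) (v i)

theorem ellipsePi_toComplex (lo hi q : ι → ℝ) :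
    ellipsePi lo hi (toComplex q) = toComplex (boxMap lo hi q) :=
  funext fun _ => ellipseMap_ofReal _ _ _

theorem boxMap_mem {lo hi : ι → ℝ} (h : ∀ i, lo i ≤ hi i) {q : ι → ℝ}
    (hq : ∀ i, q i ∈ Set.Icc (-1 : ℝ) 1) : boxMap lo hi q ∈ box lo hi := fun i => by
  have h1 := h i
  have h2 := (hq i).1
  have h3 := (hq i).2
  simp only [boxMap]
  constructor <;> nlinarith

theorem boxMapInv_mem {lo hi p : ι → ℝ} (hp : p ∈ box lo hi) (i : ι) :
    boxMapInv lo hi p i ∈ Set.Icc (-1 : ℝ) 1 := by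
  obtain ⟨h1, h2⟩ := hp i
  rcases (h1.trans h2).eq_or_lt with h | h
  · simp [boxMapInv, h]
  · have h3 : 0 < hi i - lo i := sub_pos.2 h
    simp only [boxMapInv, Set.mem_Icc]
    rw [le_div_iff₀ h3, div_le_iff₀ h3]
    constructor <;> linarith

theorem boxMap_boxMapInv {lo hi p : ι → ℝ} (hp : p ∈ box lo hi) :
    boxMap lo hi (boxMapInv lo hi p) = p := by
  funext i
  obtain ⟨h1, h2⟩ := hp i
  rcases (h1.trans h2).eq_or_lt with h | h
  · simp only [boxMap, boxMapInv, h, sub_self, zero_div, zero_mul, add_zero]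
    linarith
  · have h3 : hi i - lo i ≠ 0 := (sub_pos.2 h).ne'
    simp only [boxMap, boxMapInv]
    field_simp
    ring

end Cube

theorem exists_one_lt_le {ι : Type*} [Finite ι] [Nonempty ι] {f : ι → ℝ} (hf : ∀ i, 1 < f i) :
    ∃ ϱ : ℝ, 1 < ϱ ∧ ∀ i, ϱ ≤ f i := by
  obtain ⟨i, hi⟩ := Finite.exists_min f
  exact ⟨f i, hf i, hi⟩

end ChebAffine

/-! ### Error bound for the prices in affine models -/

theorem corollary5 {m d k : ℕ} {Ω : Type*} [MeasurableSpace Ω]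
    -- the hyperrectangle `𝒫 = 𝒫¹ × 𝒫²`, with `𝒫²` a set of triples `(t, x, π')`
    (lo hi : ChebAffine.ParamIdx m d k → ℝ) (hlohi : ∀ i, lo i ≤ hi i)
    -- the family of affine processes
    (𝔇 : Set (EuclideanSpace ℝ (Fin d)))
    (X : (Fin k → ℝ) → ℝ≥0 → Ω → EuclideanSpace ℝ (Fin d))
    (P : (Fin k → ℝ) → EuclideanSpace ℝ (Fin d) → Measure Ω)
    (ν : (Fin k → ℝ) → ℝ → (Fin d → ℂ) → ℂ)
    (φ : (Fin k → ℝ) → ℝ → (Fin d → ℂ) → (Fin d → ℂ))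
    (htime : 0 ≤ ChebAffine.timePart (ChebAffine.modelPart lo))
    (hstate : ∀ q ∈ ChebAffine.box (ChebAffine.modelPart lo) (ChebAffine.modelPart hi),
      WithLp.toLp 2 (ChebAffine.statePart q) ∈ 𝔇)
    (haffine : ∀ q ∈ ChebAffine.box (ChebAffine.modelPart lo) (ChebAffine.modelPart hi),
      ChebAffine.IsAffineProcess 𝔇 (X (ChebAffine.affinePart q)) (P (ChebAffine.affinePart q))
        (ν (ChebAffine.affinePart q)) (φ (ChebAffine.affinePart q)))
    -- the family of payoffs
    (f : (Fin m → ℝ) → EuclideanSpace ℝ (Fin d) → ℝ)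
    (hf : ∀ p ∈ ChebAffine.box (ChebAffine.payoffPart lo) (ChebAffine.payoffPart hi),
      Measurable (f p) ∧ ∀ x, 0 ≤ f p x)
    -- conditions (A1)--(A3)
    (η : EuclideanSpace ℝ (Fin d)) (ϱ₁ : Fin m → ℝ) (hϱ₁ : ∀ i, 1 < ϱ₁ i)
    (hA1 : ChebAffine.CondA1 f (ChebAffine.payoffPart lo) (ChebAffine.payoffPart hi) η)
    (hA2 : ChebAffine.CondA2 f (ChebAffine.payoffPart lo) (ChebAffine.payoffPart hi) ϱ₁ η)
    (hA3 : ChebAffine.CondA3 X P (ChebAffine.modelPart lo) (ChebAffine.modelPart hi) η)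
    -- (i) the affine transform formula extends to `ℝᵈ + i η`
    (h_i : ∀ q ∈ ChebAffine.box (ChebAffine.modelPart lo) (ChebAffine.modelPart hi),
      ∀ z : EuclideanSpace ℝ (Fin d),
        ChebAffine.charFunShifted (X (ChebAffine.affinePart q)) (P (ChebAffine.affinePart q))
            (ChebAffine.timePart q) (WithLp.toLp 2 (ChebAffine.statePart q)) η z =
          Complex.exp
            (ν (ChebAffine.affinePart q) (ChebAffine.timePart q) (ChebAffine.shifted η z) +
              ChebAffine.pairing
                (φ (ChebAffine.affinePart q) (ChebAffine.timePart q) (ChebAffine.shifted η z))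
                (ChebAffine.toComplex (ChebAffine.statePart q))))
    -- (ii) `νe z` and `φe z` are analytic extensions of the maps
    -- `(t, π') ↦ ν^{π'}(t, i z - η)` and `(t, π') ↦ φ^{π'}(t, i z - η)`
    (ϱ' : Unit ⊕ Fin k → ℝ) (hϱ' : ∀ i, 1 < ϱ' i)
    (νe : EuclideanSpace ℝ (Fin d) → (Unit ⊕ Fin k → ℂ) → ℂ)
    (φe : EuclideanSpace ℝ (Fin d) → (Unit ⊕ Fin k → ℂ) → (Fin d → ℂ))
    (h_ii_ext : ∀ z : EuclideanSpace ℝ (Fin d),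
      ∀ q ∈ ChebAffine.box (ChebAffine.modelPart lo) (ChebAffine.modelPart hi),
        νe z (ChebAffine.toComplex (ChebAffine.timeAffinePart q)) =
          ν (ChebAffine.affinePart q) (ChebAffine.timePart q) (ChebAffine.shifted η z) ∧
        φe z (ChebAffine.toComplex (ChebAffine.timeAffinePart q)) =
          φ (ChebAffine.affinePart q) (ChebAffine.timePart q) (ChebAffine.shifted η z))
    (h_ii_analytic : ∀ z : EuclideanSpace ℝ (Fin d),
      AnalyticOn ℂ (νe z)
        (ChebAffine.genBernsteinEllipse
          (ChebAffine.timeAffinePart (ChebAffine.modelPart lo))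
          (ChebAffine.timeAffinePart (ChebAffine.modelPart hi)) ϱ') ∧
      AnalyticOn ℂ (φe z)
        (ChebAffine.genBernsteinEllipse
          (ChebAffine.timeAffinePart (ChebAffine.modelPart lo))
          (ChebAffine.timeAffinePart (ChebAffine.modelPart hi)) ϱ'))
    -- (iii) the upper bound, uniformly on a generalized Bernstein ellipse around `𝒫²`
    (ϱ₂ : ChebAffine.ModelIdx d k → ℝ) (hϱ₂ : ∀ i, 1 < ϱ₂ i)
    (α C₁ C₂ : ℝ) (hα : 1 < α ∧ α ≤ 2) (hC₁ : 0 < C₁) (hC₂ : 0 < C₂)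
    (h_iii : ∀ q ∈ ChebAffine.genBernsteinEllipse
        (ChebAffine.modelPart lo) (ChebAffine.modelPart hi) ϱ₂,
      ∀ z : EuclideanSpace ℝ (Fin d),
        (νe z (ChebAffine.timeAffinePart q) +
          ChebAffine.pairing (φe z (ChebAffine.timeAffinePart q))
            (ChebAffine.statePart q)).re ≤ C₁ - C₂ * ‖z‖ ^ α) :
    -- the prices are finite, and the interpolation error decays (sub)exponentially
    (∀ p ∈ ChebAffine.box lo hi, Integrable
      (fun ω => f (ChebAffine.payoffPart p)
        (X (ChebAffine.affinePart (ChebAffine.modelPart p))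
          (ChebAffine.timePart (ChebAffine.modelPart p)).toNNReal ω))
      (P (ChebAffine.affinePart (ChebAffine.modelPart p))
        (WithLp.toLp 2 (ChebAffine.statePart (ChebAffine.modelPart p))))) ∧
    ∃ C ϱ : ℝ, 0 < C ∧ 1 < ϱ ∧
      ∀ N : ChebAffine.ParamIdx m d k → ℕ, ∀ p ∈ ChebAffine.box lo hi,
        |ChebAffine.price f X P p -
            ChebAffine.chebInterp lo hi N (ChebAffine.price f X P) p| ≤
          C * ϱ⁻¹ ^ (Finset.univ.inf' Finset.univ_nonempty N) := by
  classical
  obtain ⟨F, hFan, hFext, c₁, c₂, hc₁, hc₂, hFle⟩ := hA2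
  -- One radius below all those in (A2), (ii) and (iii), so that all three apply on the same product
  -- of ellipses.
  obtain ⟨ϱ, hϱ1, hϱle⟩ := ChebAffine.exists_one_lt_le
    (f := Sum.elim ϱ₁ (Sum.elim ϱ' ϱ₂)) (by
      rintro (i | i | i)
      exacts [hϱ₁ i, hϱ' i, hϱ₂ i])
  -- Any `r` with `1 < r` and `r ^ 2 < ϱ` would do.
  set r := √((1 + ϱ) / 2) with hr_def
  have hr2 : r ^ 2 = (1 + ϱ) / 2 := Real.sq_sqrt (by linarith)
  have hr : 1 < r := by
    rw [hr_def, Real.lt_sqrt zero_le_one]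
    linarith
  have hrϱ : r ^ 2 < ϱ := by linarith
  set S : EuclideanSpace ℝ (Fin d) → EuclideanSpace ℝ (Fin d) := fun w => (2 * Real.pi) • w
  -- The integrand of the Fourier representation, continued to complex parameters and pulled back to
  -- the unit ellipses. The variable `w = z / 2π` absorbs the factor `(2π)^{-d}`.
  set H : EuclideanSpace ℝ (Fin d) → (ChebAffine.ParamIdx m d k → ℂ) → ℂ := fun w v =>
    F (-S w) (ChebAffine.payoffPart (ChebAffine.ellipsePi lo hi v)) *
      Complex.exp
        (νe (S w) (ChebAffine.timeAffinePart
            (ChebAffine.modelPart (ChebAffine.ellipsePi lo hi v))) +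
          ChebAffine.pairing
            (φe (S w) (ChebAffine.timeAffinePart
              (ChebAffine.modelPart (ChebAffine.ellipsePi lo hi v))))
            (ChebAffine.statePart (ChebAffine.modelPart (ChebAffine.ellipsePi lo hi v)))) with hH
  set V : EuclideanSpace ℝ (Fin d) → ℝ := fun w =>
    c₁ * Real.exp C₁ * Real.exp (c₂ * ‖S w‖ - C₂ * ‖S w‖ ^ α) with hV
  have h2pi : (2 * Real.pi) ≠ 0 := Real.two_pi_pos.ne'
  have hVint : Integrable V :=
    ((ChebAffine.integrable_exp_sub_rpow volume c₂ hC₂ hα.1).comp_smul h2pi).const_mul _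
  have hmem₁ : ∀ v : ChebAffine.ParamIdx m d k → ℂ,
      (∀ i, v i ∈ ChebAffine.bernsteinEllipse ϱ) →
      ChebAffine.payoffPart (ChebAffine.ellipsePi lo hi v) ∈ ChebAffine.genBernsteinEllipse
        (ChebAffine.payoffPart lo) (ChebAffine.payoffPart hi) ϱ₁ := fun v hv i =>
    ⟨_, ChebAffine.bernsteinEllipse_subset hϱ1 (hϱle (Sum.inl i)) (hv (Sum.inl i)), rfl⟩
  have hmem' : ∀ v : ChebAffine.ParamIdx m d k → ℂ,
      (∀ i, v i ∈ ChebAffine.bernsteinEllipse ϱ) →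
      ChebAffine.timeAffinePart (ChebAffine.modelPart (ChebAffine.ellipsePi lo hi v)) ∈
        ChebAffine.genBernsteinEllipse (ChebAffine.timeAffinePart (ChebAffine.modelPart lo))
          (ChebAffine.timeAffinePart (ChebAffine.modelPart hi)) ϱ' := by
    rintro v hv (i | i)
    · exact ⟨_, ChebAffine.bernsteinEllipse_subset hϱ1 (hϱle (Sum.inr (Sum.inl (Sum.inl i))))
        (hv (Sum.inr (Sum.inl ()))), rfl⟩
    · exact ⟨_, ChebAffine.bernsteinEllipse_subset hϱ1 (hϱle (Sum.inr (Sum.inl (Sum.inr i))))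
        (hv (Sum.inr (Sum.inr (Sum.inr i)))), rfl⟩
  have hmem₂ : ∀ v : ChebAffine.ParamIdx m d k → ℂ,
      (∀ i, v i ∈ ChebAffine.bernsteinEllipse ϱ) →
      ChebAffine.modelPart (ChebAffine.ellipsePi lo hi v) ∈ ChebAffine.genBernsteinEllipse
        (ChebAffine.modelPart lo) (ChebAffine.modelPart hi) ϱ₂ := fun v hv i =>
    ⟨_, ChebAffine.bernsteinEllipse_subset hϱ1 (hϱle (Sum.inr (Sum.inr i))) (hv (Sum.inr i)), rfl⟩
  have hHolo : ∀ w, ChebAffine.SepHolo ϱ (V w) (H w) := fun w => by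
    constructor
    · intro v hv i
      have hup := fun u (hu : u ∈ ChebAffine.bernsteinEllipse ϱ) =>
        ChebAffine.update_mem hv i hu
      have hcoord : ∀ j, Differentiable ℂ fun u : ℂ =>
          ChebAffine.ellipsePi lo hi (Function.update v i u) j := fun j => by
        simp only [ChebAffine.ellipsePi, ChebAffine.ellipseMap_eq]
        have : Differentiable ℂ fun u : ℂ => Function.update v i u j := by
          by_cases hj : j = i
          · subst hj
            simp
          · simp [hj]
        fun_prop
      have hpay : Differentiable ℂ fun u : ℂ =>
          ChebAffine.payoffPart (ChebAffine.ellipsePi lo hi (Function.update v i u)) :=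
        differentiable_pi.2 fun j => hcoord _
      have htime : Differentiable ℂ fun u : ℂ => ChebAffine.timeAffinePart
          (ChebAffine.modelPart (ChebAffine.ellipsePi lo hi (Function.update v i u))) :=
        differentiable_pi.2 fun j => by
          rcases j with j | j <;> exact hcoord _
      -- Differentiability within the ellipse is enough for the composition. This covers one-point
      -- intervals, whose transformed ellipse is a single point.
      have hF := (hFan (-S w)).differentiableOn.comp hpay.differentiableOn
        fun u hu => hmem₁ _ (hup u hu)
      have hν := (h_ii_analytic (S w)).1.differentiableOn.comp htime.differentiableOn
        fun u hu => hmem' _ (hup u hu)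
      have hφ := (h_ii_analytic (S w)).2.differentiableOn.comp htime.differentiableOn
        fun u hu => hmem' _ (hup u hu)
      refine hF.mul (DifferentiableOn.cexp (hν.add ?_))
      exact DifferentiableOn.fun_sum fun j _ =>
        (differentiableOn_pi.1 hφ j).mul (hcoord _).differentiableOn
    · intro v hv
      have h1 := hFle (S w) _ (hmem₁ v hv)
      have h2 := h_iii _ (hmem₂ v hv) (S w)
      rw [hH, hV, norm_mul, Complex.norm_exp]
      calc _ ≤ (c₁ * Real.exp (c₂ * ‖S w‖)) * Real.exp (C₁ - C₂ * ‖S w‖ ^ α) :=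
            mul_le_mul h1 (Real.exp_le_exp.2 h2) (Real.exp_pos _).le (by positivity)
        _ = c₁ * Real.exp C₁ * Real.exp (c₂ * ‖S w‖ - C₂ * ‖S w‖ ^ α) := by
            rw [mul_assoc, mul_assoc, ← Real.exp_add, ← Real.exp_add]
            congr 2
            ring
  have hprice : ∀ q : ChebAffine.ParamIdx m d k → ℝ, (∀ i, q i ∈ Set.Icc (-1 : ℝ) 1) →
      Integrable (fun ω => f (ChebAffine.payoffPart (ChebAffine.boxMap lo hi q))
        (X (ChebAffine.affinePart (ChebAffine.modelPart (ChebAffine.boxMap lo hi q)))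
          (ChebAffine.timePart (ChebAffine.modelPart (ChebAffine.boxMap lo hi q))).toNNReal ω))
        (P (ChebAffine.affinePart (ChebAffine.modelPart (ChebAffine.boxMap lo hi q)))
          (WithLp.toLp 2 (ChebAffine.statePart
            (ChebAffine.modelPart (ChebAffine.boxMap lo hi q))))) ∧
      Integrable (fun w => H w (ChebAffine.toComplex q)) ∧
      ((ChebAffine.price f X P (ChebAffine.boxMap lo hi q) : ℝ) : ℂ) =
        ∫ w, H w (ChebAffine.toComplex q) := fun q hq => by
    set p := ChebAffine.boxMap lo hi q with hp
    have hpbox : p ∈ ChebAffine.box lo hi := ChebAffine.boxMap_mem hlohi hq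
    have hp₁ : ChebAffine.payoffPart p ∈
        ChebAffine.box (ChebAffine.payoffPart lo) (ChebAffine.payoffPart hi) := fun i => hpbox _
    have hp₂ : ChebAffine.modelPart p ∈
        ChebAffine.box (ChebAffine.modelPart lo) (ChebAffine.modelPart hi) := fun i => hpbox _
    have hqm : ∀ i, ChebAffine.toComplex q i ∈ ChebAffine.bernsteinEllipse ϱ := fun i =>
      ChebAffine.ofReal_mem_bernsteinEllipse hϱ1 (hq i)
    have htimeC : ChebAffine.timeAffinePart (ChebAffine.modelPart (ChebAffine.toComplex p)) =
        ChebAffine.toComplex (ChebAffine.timeAffinePart (ChebAffine.modelPart p)) := by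
      funext j
      rcases j with j | j <;> rfl
    have hchar : ∀ z, ChebAffine.charFunShifted
        (X (ChebAffine.affinePart (ChebAffine.modelPart p)))
        (P (ChebAffine.affinePart (ChebAffine.modelPart p)))
        (ChebAffine.timePart (ChebAffine.modelPart p))
        (WithLp.toLp 2 (ChebAffine.statePart (ChebAffine.modelPart p))) η z =
        Complex.exp
          (νe z (ChebAffine.timeAffinePart (ChebAffine.modelPart (ChebAffine.toComplex p))) +
            ChebAffine.pairing
              (φe z (ChebAffine.timeAffinePart (ChebAffine.modelPart (ChebAffine.toComplex p))))
              (ChebAffine.statePart (ChebAffine.modelPart (ChebAffine.toComplex p)))) :=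
      fun z => by
        rw [h_i _ hp₂ z, htimeC, (h_ii_ext z _ hp₂).1, (h_ii_ext z _ hp₂).2]
        rfl
    have hHq : ∀ w, ChebAffine.dampedFourier (f (ChebAffine.payoffPart p)) η (-S w) *
        ChebAffine.charFunShifted
        (X (ChebAffine.affinePart (ChebAffine.modelPart p)))
        (P (ChebAffine.affinePart (ChebAffine.modelPart p)))
        (ChebAffine.timePart (ChebAffine.modelPart p))
        (WithLp.toLp 2 (ChebAffine.statePart (ChebAffine.modelPart p))) η (S w) =
        H w (ChebAffine.toComplex q) := fun w => by
      rw [hH, hchar, ← hFext _ _ hp₁]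
      simp only [ChebAffine.ellipsePi_toComplex]
      rfl
    -- The growth rate `0` leaves the bound from (iii) alone: inversion needs the characteristic
    -- function itself to be integrable.
    have hB : Integrable fun w => Real.exp C₁ * Real.exp (0 * ‖S w‖ - C₂ * ‖S w‖ ^ α) :=
      ((ChebAffine.integrable_exp_sub_rpow volume 0 hC₂ hα.1).comp_smul h2pi).const_mul _
    have hbound : ∀ w, ‖ChebAffine.charFunShifted
        (X (ChebAffine.affinePart (ChebAffine.modelPart p)))
        (P (ChebAffine.affinePart (ChebAffine.modelPart p)))
        (ChebAffine.timePart (ChebAffine.modelPart p))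
        (WithLp.toLp 2 (ChebAffine.statePart (ChebAffine.modelPart p))) η (S w)‖ ≤
        Real.exp C₁ * Real.exp (0 * ‖S w‖ - C₂ * ‖S w‖ ^ α) := fun w => by
      have h2 := h_iii _ (hmem₂ _ hqm) (S w)
      rw [ChebAffine.ellipsePi_toComplex] at h2
      rw [hchar, Complex.norm_exp, ← Real.exp_add, Real.exp_le_exp]
      linarith
    obtain ⟨h1, h2, h3⟩ := ChebAffine.expectation_eq_integral_fourier
      ((haffine _ hp₂).measurable _) (hA3 _ hp₂) (hf _ hp₁).1 (hA1 _ hp₁) hB hbound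
    refine ⟨h1, h2.congr (Filter.Eventually.of_forall hHq), h3.trans ?_⟩
    exact integral_congr_ae (Filter.Eventually.of_forall hHq)
  refine ⟨fun p hp => ?_, ?_⟩
  · have := (hprice _ (ChebAffine.boxMapInv_mem hp)).1
    rwa [ChebAffine.boxMap_boxMapInv hp] at this
  have hV0 : ∀ w, 0 ≤ V w := fun w => by positivity
  set A := (1 + ChebAffine.interpConst r) ^ Fintype.card (ChebAffine.ParamIdx m d k) - 1
  have hA : 0 ≤ A := sub_nonneg.2
    (one_le_pow₀ (by linarith [ChebAffine.interpConst_nonneg hr]))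
  have hVi : 0 ≤ ∫ w, V w := integral_nonneg hV0
  -- The summand `1` only ensures that the constant is positive.
  refine ⟨A * (∫ w, V w) + 1, r, by positivity, hr, fun N p hp => ?_⟩
  set n := Finset.univ.inf' Finset.univ_nonempty N
  have hn : ∀ i, n ≤ N i := fun i => Finset.inf'_le _ (Finset.mem_univ i)
  set q := ChebAffine.boxMapInv lo hi p with hq
  have hqm : ∀ i, q i ∈ Set.Icc (-1 : ℝ) 1 := ChebAffine.boxMapInv_mem hp
  -- Linearity: the error for the price is the integral over `w` of the errors for the integrands `H
  -- w`.
  have hdiff : ((ChebAffine.price f X P p -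
      ChebAffine.chebInterp lo hi N (ChebAffine.price f X P) p : ℝ) : ℂ) =
      ∫ w, (H w (ChebAffine.toComplex q) - ∑ j ∈ ChebAffine.multiIdx N,
        ((∏ i, ChebAffine.interpWeight (N i) (j i) (q i) : ℝ) : ℂ) *
          H w (ChebAffine.toComplex fun i => ChebAffine.chebNode (N i) (j i))) := by
    have hnode := fun j : ChebAffine.ParamIdx m d k → ℕ =>
      hprice (fun i => ChebAffine.chebNode (N i) (j i)) fun i => ChebAffine.chebNode_mem _ _
    rw [integral_sub (hprice q hqm).2.1
      (integrable_finsetSum _ fun j _ => (hnode j).2.1.const_mul _),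
      integral_finsetSum _ fun j _ => (hnode j).2.1.const_mul _, ← (hprice q hqm).2.2,
      hq, ChebAffine.boxMap_boxMapInv hp, ChebAffine.chebInterp,
      ChebAffine.chebInterpUnit_eq_sum, Complex.ofReal_sub, Complex.ofReal_sum]
    congr 1
    refine Finset.sum_congr rfl fun j _ => ?_
    rw [integral_const_mul, ← (hnode j).2.2, Complex.ofReal_mul]
  rw [← Real.norm_eq_abs, ← Complex.norm_real, hdiff]
  refine (norm_integral_le_of_norm_le ((hVint.const_mul A).mul_const (r⁻¹ ^ n))
    (Filter.Eventually.of_forall fun w => (hHolo w).norm_sub_sum_le hr hrϱ N hqm n hn)).trans ?_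
  rw [integral_mul_const, integral_const_mul]
  gcongr
  linarith
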